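/- Let $\mathcal A=\{A_1,\dots,A_d\}$ be a commuting family of complex $n\times n$ matrices. Its joint eigenvalues $\boldsymbol\lambda^{(1)},\dots,\boldsymbol\lambda^{(n)}\in\mathbb C^d$ are the $d$-tuples of diagonal entries $((U^*A_1U)_{ii},\dots,(U^*A_dU)_{ii})$, $i=1,\dots,n$, where $U$ is a unitary matrix such that all $U^*A_kU$ are upper triangular. Let $\boldsymbol\lambda=(\lambda_1,\dots,\lambda_d)$ be a semisimple joint eigenvalue of multiplicity $p\ge 1$, that is, $\boldsymbol\lambda$ occurs exactly $p$ times in the list $\boldsymbol\lambda^{(1)},\dots,\boldsymbol\lambda^{(n)}$ and $\dim\bigcap_{k}\ker(A_k-\lambda_kI_n)=p$. Let $X=[X_1\ X_2]$, $Y=[Y_1\ Y_2]\in\mathbb C^{n\times n}$, with $X_1,Y_1\in\mathbb C^{n\times p}$, satisfy $$X_1^*X_1=I_p,\qquad Y^*X=I_n,\qquad Y^*A_kX=\begin{bmatrix}\lambda_kI_p&0\\0&A_{22}^{(k)}\end{bmatrix},\quad k=1,\dots,d,$$ for some $A_{22}^{(k)}\in\mathbb C^{(n-p)\times(n-p)}$.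 For $\mu\in\mathbb C^d$ write $A(\mu)=\sum_k\mu_kA_k$, $A_{22}(\mu)=\sum_k\mu_kA_{22}^{(k)}$, $\lambda(\mu)=\sum_k\mu_k\lambda_k$ and $\lambda_j(\mu)=\sum_k\mu_k\lambda^{(j)}_k$. Fix $\mu$ with $\|\mu\|_2=1$ such that $\lambda(\mu)$ is not an eigenvalue of $A_{22}(\mu)$. For matrices $E_1,\dots,E_d\in\mathbb C^{n\times n}$ with $\|E_1\|_F^2+\cdots+\|E_d\|_F^2=1$ and for $\epsilon>0$ put $\widetilde A_k=A_k+\epsilon E_k$ and $\widetilde A(\mu)=\sum_k\mu_k\widetilde A_k$. Suppose that the $p$ eigenvalues of $\widetilde A(\mu)$ closest to $\lambda(\mu)$ (counted with algebraic multiplicity) are semisimple, and let $\widetilde X_1=[\widetilde x_1\ \cdots\ \widetilde x_p]$ and $\widetilde Y_1=[\widetilde y_1\ \cdots\ \widetilde y_p]$ contain corresponding right and left eigenvectors of $\widetilde A(\mu)$, normalized such that $\widetilde Y_1^*\widetilde X_1=I_p$ and $\|\widetilde x_i\|_2=1$ for all $i$. Below, $\mathcal O(\epsilon^2)$ stands for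 a term bounded by $C\epsilon^2$ for all $0<\epsilon<\delta$, where the constants $C$ and $\delta>0$ do not depend on $\epsilon$, on $E_1,\dots,E_d$, or on the choice of $\widetilde X_1,\widetilde Y_1$ (they may depend on $\mathcal A,\boldsymbol\lambda,X,Y,\mu$). Then: 1) The two-sided Rayleigh quotients $\widetilde{\boldsymbol\lambda}^{(i)}_{\mathrm{RQ2}}:=(\widetilde y_i^*\widetilde A_1\widetilde x_i,\dots,\widetilde y_i^*\widetilde A_d\widetilde x_i)$ satisfy $$\|\widetilde{\boldsymbol\lambda}^{(i)}_{\mathrm{RQ2}}-\boldsymbol\lambda\|_2\le\|\widetilde y_i\|_2\,\epsilon+\mathcal O(\epsilon^2),\qquad i=1,\dots,p.$$ 2) If, in addition, $Y^*A_kX$ is diagonal for $k=1,\dots,d$ (so that $\mathcal A$ is simultaneously diagonalizable), then the one-sided Rayleigh quotients $\widetilde{\boldsymbol\lambda}^{(i)}_{\mathrm{RQ1}}:=(\widetilde x_i^*\widetilde A_1\widetilde x_i,\dots,\widetilde x_i^*\widetilde A_d\widetilde x_i)$ satisfy $$\|\widetilde{\boldsymbol\lambda}^{(i)}_{\mathrm{RQ1}}-\boldsymbol\lambda\|_2\le\Big(1+\frac{\sqrt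 d\,\|X_2\|_2\|Y_2\|_2}{d(\mu)}\Big)\epsilon+\mathcal O(\epsilon^2),\qquad i=1,\dots,p,$$ where $$d(\mu):=\min_{\boldsymbol\lambda^{(j)}\ne\boldsymbol\lambda}\frac{|\lambda_j(\mu)-\lambda(\mu)|}{\|\boldsymbol\lambda^{(j)}-\boldsymbol\lambda\|_2}$$ (if $p=n$ there is no such $j$, $X_2$ and $Y_2$ are empty, and the fraction in the bound is read as $0$). Here $\|\cdot\|_2$ is the Euclidean norm of vectors and the spectral norm of matrices, and $\|\cdot\|_F$ is the Frobenius norm. -/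

import Mathlib

open scoped Matrix
open scoped Matrix.Norms.L2Operator

namespace JointEig

noncomputable section

/-- The family `A 0, …, A (d-1)` of complex `n × n` matrices is commuting. -/
def IsCommutingFamily {n d : ℕ} (A : Fin d → Matrix (Fin n) (Fin n) ℂ) : Prop :=
  ∀ j k, A j * A k = A k * A j

/-- `Λ 0, …, Λ (n-1)` is the list of joint eigenvalues of the family `A`: there is a unitary `U`
such that all `U* A_k U` are upper triangular, and `Λ i` is the `d`-tuple of their `i`-th
diagonal entries. -/
def IsJointEigenvalueList {n d : ℕ} (A : Fin d → Matrix (Fin n) (Fin n) ℂ)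
    (Λ : Fin n → EuclideanSpace ℂ (Fin d)) : Prop :=
  ∃ U ∈ Matrix.unitaryGroup (Fin n) ℂ,
    (∀ k, (Uᴴ * A k * U).BlockTriangular id) ∧
      ∀ i k, Λ i k = (Uᴴ * A k * U) i i

/-- The common right eigenspace `⋂ₖ ker (A_k - λ_k I)`. -/
def commonEigenspace {n d : ℕ} (A : Fin d → Matrix (Fin n) (Fin n) ℂ)
    (lam : EuclideanSpace ℂ (Fin d)) : Submodule ℂ (Fin n → ℂ) :=
  ⨅ k, LinearMap.ker (Matrix.toLin' (A k - lam k • (1 : Matrix (Fin n) (Fin n) ℂ)))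

/-- The algebraic multiplicity of `lam`: the number of times it occurs in the list `Λ` of joint
eigenvalues. -/
def algMultiplicity {n d : ℕ} (Λ : Fin n → EuclideanSpace ℂ (Fin d))
    (lam : EuclideanSpace ℂ (Fin d)) : ℕ :=
  Nat.card {i : Fin n // Λ i = lam}

/-- `lam` is a semisimple joint eigenvalue of multiplicity `p` of the family `A` with joint
eigenvalue list `Λ`: its algebraic and geometric multiplicities both equal `p ≥ 1`. -/
def IsSemisimpleJointEigenvalue {n d : ℕ} (A : Fin d → Matrix (Fin n) (Fin n) ℂ)
    (Λ : Fin n → EuclideanSpace ℂ (Fin d)) (lam : EuclideanSpace ℂ (Fin d)) (p : ℕ) : Prop :=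
  1 ≤ p ∧ algMultiplicity Λ lam = p ∧ Module.finrank ℂ (commonEigenspace A lam) = p

/-- The linear combination `A(μ) = μ₁ A₁ + ⋯ + μ_d A_d` of matrices. -/
def matComb {m d : ℕ} (A : Fin d → Matrix (Fin m) (Fin m) ℂ) (μ : EuclideanSpace ℂ (Fin d)) :
    Matrix (Fin m) (Fin m) ℂ :=
  ∑ k, μ k • A k

/-- The linear combination `λ(μ) = μ₁ λ₁ + ⋯ + μ_d λ_d` (no complex conjugation). -/
def eigComb {d : ℕ} (lam μ : EuclideanSpace ℂ (Fin d)) : ℂ :=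
  ∑ k, μ k * lam k

/-- The Frobenius norm of a matrix. -/
def frobNorm {m n : ℕ} (M : Matrix (Fin m) (Fin n) ℂ) : ℝ :=
  √(∑ i, ∑ j, ‖M i j‖ ^ 2)

/-- The `i`-th column of a matrix as a vector of the Euclidean space. -/
def colVec {n p : ℕ} (X : Matrix (Fin n) (Fin p) ℂ) (i : Fin p) : EuclideanSpace ℂ (Fin n) :=
  WithLp.toLp 2 (fun a => X a i)

/-- `X = [X₁ X₂]` and `Y = [Y₁ Y₂]` block diagonalize the family `A` with respect to `lam`:
`X₁* X₁ = I`, `Y* X = I` and `Y* A_k X = diag(λ_k I, A₂₂⁽ᵏ⁾)` for every `k`. -/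
structure IsBlockDiagonalization {n d p : ℕ} (A : Fin d → Matrix (Fin n) (Fin n) ℂ)
    (lam : EuclideanSpace ℂ (Fin d))
    (X₁ : Matrix (Fin n) (Fin p) ℂ) (X₂ : Matrix (Fin n) (Fin (n - p)) ℂ)
    (Y₁ : Matrix (Fin n) (Fin p) ℂ) (Y₂ : Matrix (Fin n) (Fin (n - p)) ℂ)
    (A₂₂ : Fin d → Matrix (Fin (n - p)) (Fin (n - p)) ℂ) : Prop where
  orthonormal : X₁ᴴ * X₁ = 1
  dual : (Matrix.fromCols Y₁ Y₂)ᴴ * Matrix.fromCols X₁ X₂ = 1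
  block : ∀ k, (Matrix.fromCols Y₁ Y₂)ᴴ * A k * Matrix.fromCols X₁ X₂ =
    Matrix.fromBlocks (lam k • (1 : Matrix (Fin p) (Fin p) ℂ)) 0 0 (A₂₂ k)

/-- The columns of `Xt` and `Yt` are right and left eigenvectors of `B` belonging to the `p`
eigenvalues `θ 0, …, θ (p-1)` of `B` closest to `z` (counted with algebraic multiplicity), these
eigenvalues are semisimple, `Yt* Xt = I`, and the columns of `Xt` have norm one. -/
def IsClosestEigenbasis {n p : ℕ} (B : Matrix (Fin n) (Fin n) ℂ) (z : ℂ)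
    (Xt Yt : Matrix (Fin n) (Fin p) ℂ) : Prop :=
  ∃ θ : Fin p → ℂ,
    (∃ R : Multiset ℂ, B.charpoly.roots = Finset.univ.val.map θ + R ∧
      ∀ i, ∀ r ∈ R, ‖θ i - z‖ ≤ ‖r - z‖) ∧
    (∀ i, Module.finrank ℂ (Module.End.eigenspace (Matrix.toLin' B) (θ i)) =
      B.charpoly.rootMultiplicity (θ i)) ∧
    (∀ i, B *ᵥ (fun a => Xt a i) = θ i • (fun a => Xt a i)) ∧
    (∀ i, (fun a => star (Yt a i)) ᵥ* B = θ i • (fun a => star (Yt a i))) ∧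
    Ytᴴ * Xt = 1 ∧
    ∀ i, ‖colVec Xt i‖ = 1

/-- The one-sided Rayleigh quotient `(x* A₁ x, …, x* A_d x)`. -/
def rq1 {n d : ℕ} (A : Fin d → Matrix (Fin n) (Fin n) ℂ) (x : EuclideanSpace ℂ (Fin n)) :
    EuclideanSpace ℂ (Fin d) :=
  WithLp.toLp 2 (fun k => star (x : Fin n → ℂ) ⬝ᵥ (A k *ᵥ (x : Fin n → ℂ)))

/-- The two-sided Rayleigh quotient `(y* A₁ x, …, y* A_d x)`. -/
def rq2 {n d : ℕ} (A : Fin d → Matrix (Fin n) (Fin n) ℂ) (x y : EuclideanSpace ℂ (Fin n)) :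
    EuclideanSpace ℂ (Fin d) :=
  WithLp.toLp 2 (fun k => star (y : Fin n → ℂ) ⬝ᵥ (A k *ᵥ (x : Fin n → ℂ)))

/-- `d(μ)`: the minimum of `|λ_j(μ) - λ(μ)| / ‖λ⁽ʲ⁾ - λ‖` over the joint eigenvalues
`λ⁽ʲ⁾ ≠ λ`, written as the infimum of a finite set. -/
def eigGap {n d : ℕ} (Λ : Fin n → EuclideanSpace ℂ (Fin d)) (lam μ : EuclideanSpace ℂ (Fin d)) :
    ℝ :=
  sInf ((fun j => ‖eigComb (Λ j) μ - eigComb lam μ‖ / ‖Λ j - lam‖) '' {j | Λ j ≠ lam})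

end

end JointEig

/-! Write `λ` for `lam`, `B = A(μ)`, `F = ε E(μ)`, and let `θ`, `x`, `y` be a perturbed eigenvalue
with its right and left vectors. Since `A_k - λ_k I = X₂ (A₂₂⁽ᵏ⁾ - λ_k I) Y₂ᴴ`, the error of a
Rayleigh quotient with `yᴴ x = 1` is the vector of forms `(yᴴ X₂)(A₂₂⁽ᵏ⁾ - λ_k I)(Y₂ᴴ x)` plus `ε`
times the vector of forms `yᴴ E_k x`. Continuity of eigenvalues brings `θ` close to `λ(μ)`;
inverting `A₂₂(μ) - λ(μ) I` then gives `‖Y₂ᴴ x‖ = O(‖F‖)`, `‖yᴴ X₂‖ = O(‖F‖ ‖y‖)` and `|θ - λ(μ)| =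
O(ε)`.

Two-sided quotients: the first part of the error is `O(ε² β² ‖y‖)` with `β = ‖E(μ)‖`, but `‖y‖` has
no uniform bound, since the perturbed eigenvalues may be clustered. The remedy is a trade-off. Let
`V` be the norm of the vector of `yᴴ E_k x` and `s² = 1 - V²/‖y‖²`. Then `εV` falls short of `ε‖y‖`
by at least `ε‖y‖s²/2`. Projecting each `E_k` onto `y xᴴ` shows `β ≤ |yᴴ E(μ) x|/‖y‖ + s`, and the
shift bound, which does not involve `y`, forces `|yᴴ E(μ) x|` to be bounded up to higher order. Thus
`β²` is at most a multiple of `1/‖y‖² + s²`: the first term contributes `O(ε²)`, the second is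
absorbed by the shortfall. This is `two_sided_scalar_bound`.

One-sided quotients: with `x` on the left only `Y₂ᴴ x` is small. In the diagonal case `(A₂₂(μ) -
λ(μ) I) Y₂ᴴ x` equals `-Y₂ᴴ F x` up to `O(ε²)`, and `d(μ)` compares the tuples `λ⁽ʲ⁾ - λ` with the
diagonal entries of `A₂₂(μ) - λ(μ) I`. -/

namespace JointEig

open Filter Topology Polynomial

/-! ### Spectral and Frobenius norms -/

/-- The `i`-th column of a matrix as a matrix with a single column. -/
def col {n p : ℕ} (X : Matrix (Fin n) (Fin p) ℂ) (i : Fin p) : Matrix (Fin n) Unit ℂ :=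
  Matrix.replicateCol Unit (fun a => X a i)

lemma norm_unit_matrix (M : Matrix Unit Unit ℂ) : ‖M‖ = ‖M () ()‖ := by
  have h : M = Matrix.diagonal (fun _ => M () ()) := by
    ext i j; simp
  rw [h, Matrix.l2_opNorm_diagonal, Pi.norm_def]
  simp

/-- The C*-identity reduces the spectral norm of a column to the `1 × 1` matrix `v* v`. -/
lemma norm_replicateCol {n : ℕ} (v : Fin n → ℂ) :
    ‖Matrix.replicateCol Unit v‖ = ‖(WithLp.toLp 2 v : EuclideanSpace ℂ (Fin n))‖ := by
  have h := Matrix.l2_opNorm_conjTranspose_mul_self (Matrix.replicateCol Unit v)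
  rw [norm_unit_matrix, ← sq] at h
  rw [← sq_eq_sq₀ (norm_nonneg _) (norm_nonneg _), ← h, EuclideanSpace.norm_sq_eq]
  have : ((Matrix.replicateCol Unit v)ᴴ * Matrix.replicateCol Unit v) () ()
      = ((∑ i, ‖v i‖ ^ 2 : ℝ) : ℂ) := by
    simp [Matrix.mul_apply, Complex.conj_mul']
  rw [this, Complex.norm_real, Real.norm_of_nonneg (by positivity)]

lemma norm_col {n p : ℕ} (X : Matrix (Fin n) (Fin p) ℂ) (i : Fin p) :
    ‖col X i‖ = ‖colVec X i‖ :=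
  norm_replicateCol _

lemma norm_sq_column {n : ℕ} (x : Matrix (Fin n) Unit ℂ) : ‖x‖ ^ 2 = ∑ i, ‖x i ()‖ ^ 2 := by
  have h := norm_replicateCol (fun i => x i ())
  have e : Matrix.replicateCol Unit (fun i => x i ()) = x := by ext i j; rfl
  rw [e] at h
  rw [h, EuclideanSpace.norm_sq_eq]

lemma frobNorm_nonneg {m n : ℕ} (M : Matrix (Fin m) (Fin n) ℂ) : 0 ≤ frobNorm M :=
  Real.sqrt_nonneg _

lemma frobNorm_sq {m n : ℕ} (M : Matrix (Fin m) (Fin n) ℂ) :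
    frobNorm M ^ 2 = ∑ i, ∑ j, ‖M i j‖ ^ 2 :=
  Real.sq_sqrt (by positivity)

lemma norm_le_frobNorm {m n : ℕ} (M : Matrix (Fin m) (Fin n) ℂ) : ‖M‖ ≤ frobNorm M := by
  rw [Matrix.l2_opNorm_def]
  refine ContinuousLinearMap.opNorm_le_bound _ (frobNorm_nonneg M) fun x => ?_
  refine (sq_le_sq₀ (norm_nonneg _) (mul_nonneg (frobNorm_nonneg M) (norm_nonneg _))).mp ?_
  rw [mul_pow, frobNorm_sq, EuclideanSpace.norm_sq_eq, EuclideanSpace.norm_sq_eq x,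
    Finset.sum_mul]
  refine Finset.sum_le_sum fun i _ => ?_
  have h1 : ‖∑ j, M i j * x j‖ ≤ ∑ j, ‖M i j‖ * ‖x j‖ :=
    (norm_sum_le _ _).trans_eq (by simp)
  calc _ = ‖∑ j, M i j * x j‖ ^ 2 := rfl
    _ ≤ (∑ j, ‖M i j‖ * ‖x j‖) ^ 2 := by gcongr
    _ ≤ _ := Finset.sum_mul_sq_le_sq_mul_sq _ _ _

/-- Cauchy–Schwarz for a linear combination of matrices. -/
lemma norm_matComb_le {n d : ℕ} (E : Fin d → Matrix (Fin n) (Fin n) ℂ)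
    (μ : EuclideanSpace ℂ (Fin d)) :
    ‖matComb E μ‖ ≤ ‖μ‖ * √(∑ k, frobNorm (E k) ^ 2) := by
  calc ‖matComb E μ‖ ≤ ∑ k, ‖μ k‖ * frobNorm (E k) := by
        refine (norm_sum_le _ _).trans (Finset.sum_le_sum fun k _ => ?_)
        rw [norm_smul]
        exact mul_le_mul_of_nonneg_left (norm_le_frobNorm _) (norm_nonneg _)
    _ ≤ √(∑ k, ‖μ k‖ ^ 2) * √(∑ k, frobNorm (E k) ^ 2) := Real.sum_mul_le_sqrt_mul_sqrt _ _ _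
    _ = _ := by rw [← EuclideanSpace.norm_eq]

lemma norm_eigComb_le {d : ℕ} (v μ : EuclideanSpace ℂ (Fin d)) :
    ‖eigComb v μ‖ ≤ ‖μ‖ * ‖v‖ := by
  calc ‖eigComb v μ‖ ≤ ∑ k, ‖μ k‖ * ‖v k‖ :=
        (norm_sum_le _ _).trans_eq (by simp)
    _ ≤ √(∑ k, ‖μ k‖ ^ 2) * √(∑ k, ‖v k‖ ^ 2) := Real.sum_mul_le_sqrt_mul_sqrt _ _ _
    _ = _ := by rw [← EuclideanSpace.norm_eq, ← EuclideanSpace.norm_eq]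

/-! ### Continuity of eigenvalues with multiplicity -/

lemma exists_charpoly_eq_prod {n : ℕ} (B : Matrix (Fin n) (Fin n) ℂ) :
    ∃ w : Fin n → ℂ, B.charpoly = ∏ i, (X - C (w i)) ∧
      B.charpoly.roots = Finset.univ.val.map w := by
  have hs : B.charpoly.Splits := IsAlgClosed.splits _
  have hc : B.charpoly.roots.card = n := by
    rw [← hs.natDegree_eq_card_roots, Matrix.charpoly_natDegree_eq_dim, Fintype.card_fin]
  obtain ⟨l, hl⟩ := Quot.exists_rep B.charpoly.roots
  have hl' : (l : Multiset ℂ) = B.charpoly.roots := hl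
  have hlen : l.length = n := by rw [← hc, ← hl']; simp
  subst hlen
  have hr : B.charpoly.roots = Finset.univ.val.map l.get := by
    rw [← hl', Fin.univ_def]
    simp
  refine ⟨l.get, ?_, hr⟩
  conv_lhs => rw [hs.eq_prod_roots_of_monic B.charpoly_monic, hr]
  simp only [Multiset.map_map]
  rfl

lemma norm_root_le {n : ℕ} (B : Matrix (Fin n) (Fin n) ℂ) {z : ℂ}
    (hz : z ∈ B.charpoly.roots) :
    ‖z‖ ≤ ‖B‖ * ‖(1 : Matrix (Fin n) (Fin n) ℂ)‖ :=
  spectrum.norm_le_norm_mul_of_mem (Matrix.mem_spectrum_iff_isRoot_charpoly.mpr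
    (Polynomial.isRoot_of_mem_roots hz))

/-- Continuity of eigenvalues: near an eigenvalue of multiplicity `p` of `B₀`, all matrices close
to `B₀` have at least `p` eigenvalues. -/
lemma exists_forall_le_countP_roots {n p : ℕ} (B₀ : Matrix (Fin n) (Fin n) ℂ) (z : ℂ)
    (hp : p ≤ B₀.charpoly.roots.count z) {r : ℝ} (hr : 0 < r) :
    ∃ δ > 0, ∀ B : Matrix (Fin n) (Fin n) ℂ, ‖B - B₀‖ < δ →
      p ≤ B.charpoly.roots.countP (fun w => ‖w - z‖ < r) := by
  by_contra! hcon
  choose B hB hBp using fun m : ℕ => hcon (1 / ((m : ℝ) + 1)) (by positivity)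
  have hBt : Tendsto B atTop (𝓝 B₀) := by
    rw [tendsto_iff_norm_sub_tendsto_zero]
    exact squeeze_zero (fun _ => norm_nonneg _) (fun m => (hB m).le)
      tendsto_one_div_add_atTop_nhds_zero_nat
  choose w hw hwr using fun m => exists_charpoly_eq_prod (B m)
  have hbd : ∀ m, w m ∈ Metric.closedBall (0 : Fin n → ℂ)
      ((1 + ‖B₀‖) * ‖(1 : Matrix (Fin n) (Fin n) ℂ)‖) := by
    intro m
    rw [mem_closedBall_zero_iff, pi_norm_le_iff_of_nonneg (by positivity)]
    intro i
    have hi : w m i ∈ (B m).charpoly.roots := by rw [hwr]; simp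
    refine (norm_root_le _ hi).trans ?_
    gcongr
    calc ‖B m‖ = ‖(B m - B₀) + B₀‖ := by simp
      _ ≤ ‖B m - B₀‖ + ‖B₀‖ := norm_add_le _ _
      _ ≤ 1 + ‖B₀‖ := by
        gcongr
        refine (hB m).le.trans ?_
        rw [div_le_one (by positivity)]
        simp
  -- The eigenvalue vectors of the counterexamples are bounded, so a subsequence converges. Its
  -- limit must list the roots of `B₀`, because characteristic polynomials converge pointwise.
  obtain ⟨v, -, φ, hφ, hv⟩ := (isCompact_closedBall _ _).tendsto_subseq hbd
  have hBφ : Tendsto (B ∘ φ) atTop (𝓝 B₀) := hBt.comp hφ.tendsto_atTop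
  have hpoly : B₀.charpoly = ∏ i, (X - C (v i)) := by
    refine Polynomial.funext fun t => ?_
    have h1 : Tendsto (fun m => (B (φ m)).charpoly.eval t) atTop (𝓝 (B₀.charpoly.eval t)) := by
      simp only [Matrix.eval_charpoly]
      have hcont : Continuous fun M : Matrix (Fin n) (Fin n) ℂ =>
          ((Matrix.scalar (Fin n)) t - M).det := by
        fun_prop
      exact (hcont.tendsto B₀).comp hBφ
    have h2 : Tendsto (fun m => (B (φ m)).charpoly.eval t) atTop
        (𝓝 ((∏ i, (X - C (v i))).eval t)) := by
      simp only [hw, Polynomial.eval_prod, Polynomial.eval_sub, Polynomial.eval_X,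
        Polynomial.eval_C]
      exact tendsto_finsetProd _ fun i _ =>
        tendsto_const_nhds.sub ((tendsto_pi_nhds.mp hv) i)
    exact tendsto_nhds_unique h1 h2
  have hroots : B₀.charpoly.roots = Finset.univ.val.map v := by
    rw [hpoly, Polynomial.roots_prod _ _ (Finset.prod_ne_zero_iff.mpr
      fun i _ => Polynomial.X_sub_C_ne_zero _)]
    simp
  have hev : ∀ᶠ m in atTop, ∀ i, v i = z → ‖w (φ m) i - z‖ < r := by
    rw [eventually_all]
    intro i
    have h1 := (tendsto_pi_nhds.mp hv) i
    filter_upwards [h1.eventually (Metric.ball_mem_nhds _ hr)] with m hm hi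
    rw [← hi, ← dist_eq_norm]
    exact hm
  obtain ⟨m, hm⟩ := hev.exists
  have h3 := hBp (φ m)
  rw [hwr, Multiset.countP_map] at h3
  rw [hroots, Multiset.count_map] at hp
  refine absurd (hp.trans (Multiset.card_le_card ?_)) (not_le.mpr h3)
  exact Multiset.monotone_filter_right _ fun i hi => hm i hi.symm

/-- If one `θ i` lay outside the disc, every root in `R` would too, leaving fewer than `p` roots
inside. -/
lemma IsClosestEigenbasis.eigenvalues_near {n p : ℕ} {B : Matrix (Fin n) (Fin n) ℂ} {z : ℂ}
    {θ : Fin p → ℂ} {R : Multiset ℂ} (h1 : B.charpoly.roots = Finset.univ.val.map θ + R)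
    (h2 : ∀ i, ∀ r ∈ R, ‖θ i - z‖ ≤ ‖r - z‖) {r : ℝ}
    (hB : p ≤ B.charpoly.roots.countP (fun w => ‖w - z‖ < r)) (i : Fin p) : ‖θ i - z‖ < r := by
  by_contra! hcon
  have hR : R.countP (fun w => ‖w - z‖ < r) = 0 := by
    rw [Multiset.countP_eq_zero]
    intro w hw
    exact not_lt.mpr (hcon.trans (h2 i w hw))
  rw [h1, Multiset.countP_add, hR, add_zero, Multiset.countP_map] at hB
  have : (Finset.univ.filter fun j => ‖θ j - z‖ < r).card < p := by
    conv_rhs => rw [← Fintype.card_fin p]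
    refine Finset.card_lt_univ_of_notMem (x := i) ?_
    simpa using hcon
  exact absurd hB (not_le.mpr this)

end JointEig

/-! ### Block diagonalization of the family and of `A(μ)` -/

namespace JointEig

section Block

variable {n d p : ℕ} {A : Fin d → Matrix (Fin n) (Fin n) ℂ} {lam : EuclideanSpace ℂ (Fin d)}
  {X₁ : Matrix (Fin n) (Fin p) ℂ} {X₂ : Matrix (Fin n) (Fin (n - p)) ℂ}
  {Y₁ : Matrix (Fin n) (Fin p) ℂ} {Y₂ : Matrix (Fin n) (Fin (n - p)) ℂ}
  {A₂₂ : Fin d → Matrix (Fin (n - p)) (Fin (n - p)) ℂ}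

lemma IsBlockDiagonalization.dual_blocks (h : IsBlockDiagonalization A lam X₁ X₂ Y₁ Y₂ A₂₂) :
    Y₁ᴴ * X₁ = 1 ∧ Y₁ᴴ * X₂ = 0 ∧ Y₂ᴴ * X₁ = 0 ∧ Y₂ᴴ * X₂ = 1 := by
  have h1 := h.dual
  rw [Matrix.conjTranspose_fromCols_eq_fromRows_conjTranspose, Matrix.fromRows_mul_fromCols,
    ← Matrix.fromBlocks_one, Matrix.fromBlocks_inj] at h1
  exact h1

lemma IsBlockDiagonalization.mul_conjTranspose
    (h : IsBlockDiagonalization A lam X₁ X₂ Y₁ Y₂ A₂₂) (hp : p ≤ n) :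
    Matrix.fromCols X₁ X₂ * (Matrix.fromCols Y₁ Y₂)ᴴ = 1 := by
  -- With `p ≤ n` the truncated `n - p` is the true difference, so `X` and `Y` are square and a
  -- one-sided inverse is two-sided.
  have e : Fin p ⊕ Fin (n - p) ≃ Fin n :=
    finSumFinEquiv.trans (finCongr (by omega))
  exact (Matrix.mul_eq_one_comm_of_equiv e).mp h.dual

lemma IsBlockDiagonalization.sum_projections
    (h : IsBlockDiagonalization A lam X₁ X₂ Y₁ Y₂ A₂₂) (hp : p ≤ n) :
    X₁ * Y₁ᴴ + X₂ * Y₂ᴴ = 1 := by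
  have h1 := h.mul_conjTranspose hp
  rwa [Matrix.conjTranspose_fromCols_eq_fromRows_conjTranspose,
    Matrix.fromCols_mul_fromRows] at h1

lemma IsBlockDiagonalization.eq_mul_blocks
    (h : IsBlockDiagonalization A lam X₁ X₂ Y₁ Y₂ A₂₂) (hp : p ≤ n) (k : Fin d) :
    A k = Matrix.fromCols X₁ X₂ *
      Matrix.fromBlocks (lam k • (1 : Matrix (Fin p) (Fin p) ℂ)) 0 0 (A₂₂ k) *
        (Matrix.fromCols Y₁ Y₂)ᴴ := by
  have h1 := h.mul_conjTranspose hp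
  rw [← h.block k]
  calc A k = (Matrix.fromCols X₁ X₂ * (Matrix.fromCols Y₁ Y₂)ᴴ) * A k *
        (Matrix.fromCols X₁ X₂ * (Matrix.fromCols Y₁ Y₂)ᴴ) := by rw [h1]; simp
    _ = _ := by simp only [Matrix.mul_assoc]

lemma IsBlockDiagonalization.eq_add
    (h : IsBlockDiagonalization A lam X₁ X₂ Y₁ Y₂ A₂₂) (hp : p ≤ n) (k : Fin d) :
    A k = lam k • (X₁ * Y₁ᴴ) + X₂ * A₂₂ k * Y₂ᴴ := by
  rw [h.eq_mul_blocks hp k, Matrix.conjTranspose_fromCols_eq_fromRows_conjTranspose,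
    Matrix.fromCols_mul_fromBlocks, Matrix.fromCols_mul_fromRows]
  simp

lemma IsBlockDiagonalization.sub_smul_one
    (h : IsBlockDiagonalization A lam X₁ X₂ Y₁ Y₂ A₂₂) (hp : p ≤ n) (k : Fin d) :
    A k - lam k • (1 : Matrix (Fin n) (Fin n) ℂ) =
      X₂ * (A₂₂ k - lam k • (1 : Matrix (Fin (n - p)) (Fin (n - p)) ℂ)) * Y₂ᴴ := by
  rw [← h.sum_projections hp, h.eq_add hp k]
  simp only [Matrix.mul_sub, Matrix.sub_mul, smul_add, Matrix.mul_smul, Matrix.smul_mul,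
    Matrix.mul_one]
  abel

/-- A block diagonalization of the family block diagonalizes `A(μ)`. -/
lemma IsBlockDiagonalization.matComb (h : IsBlockDiagonalization A lam X₁ X₂ Y₁ Y₂ A₂₂)
    (μ : EuclideanSpace ℂ (Fin d)) :
    IsBlockDiagonalization (fun _ : Fin 1 => matComb A μ) (WithLp.toLp 2 fun _ => eigComb lam μ)
      X₁ X₂ Y₁ Y₂ (fun _ => JointEig.matComb A₂₂ μ) where
  orthonormal := h.orthonormal
  dual := h.dual
  block := by
    intro _
    simp only [JointEig.matComb, eigComb, Matrix.mul_sum, Matrix.sum_mul, Matrix.mul_smul,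
      Matrix.smul_mul, h.block]
    ext i j
    rcases i with i | i <;> rcases j with j | j <;>
      simp [Matrix.sum_apply, Finset.sum_mul, mul_assoc]

lemma IsBlockDiagonalization.matComb_eq_add
    (h : IsBlockDiagonalization A lam X₁ X₂ Y₁ Y₂ A₂₂) (hp : p ≤ n)
    (μ : EuclideanSpace ℂ (Fin d)) :
    JointEig.matComb A μ = eigComb lam μ • (X₁ * Y₁ᴴ) + X₂ * JointEig.matComb A₂₂ μ * Y₂ᴴ :=
  (h.matComb μ).eq_add hp 0

-- Cyclic invariance of the characteristic polynomial moves `Yᴴ` next to `X`, where the two cancel.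
open Polynomial in
lemma IsBlockDiagonalization.charpoly_matComb
    (h : IsBlockDiagonalization A lam X₁ X₂ Y₁ Y₂ A₂₂) (hp : p ≤ n)
    (μ : EuclideanSpace ℂ (Fin d)) :
    (JointEig.matComb A μ).charpoly =
      (X - C (eigComb lam μ)) ^ p * (JointEig.matComb A₂₂ μ).charpoly := by
  have h1 := (h.matComb μ).eq_mul_blocks hp 0
  have hc : Fintype.card (Fin p ⊕ Fin (n - p)) = Fintype.card (Fin n) := by
    simp; omega
  rw [h1, Matrix.mul_assoc, Matrix.charpoly_mul_comm_of_le _ _ hc.le, hc, Nat.sub_self, pow_zero,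
    one_mul, Matrix.mul_assoc, h.dual, Matrix.mul_one, Matrix.charpoly_fromBlocks_zero₁₂,
    Matrix.smul_one_eq_diagonal, Matrix.charpoly_diagonal]
  simp

lemma not_mem_roots_of_not_hasEigenvalue {m : ℕ} {M : Matrix (Fin m) (Fin m) ℂ} {z : ℂ}
    (hsep : ¬ Module.End.HasEigenvalue (Matrix.toLin' M) z) : ¬ M.charpoly.IsRoot z := by
  rw [Module.End.hasEigenvalue_iff_mem_spectrum, Matrix.spectrum_toLin',
    Matrix.mem_spectrum_iff_isRoot_charpoly] at hsep
  exact hsep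

open Polynomial in
lemma IsBlockDiagonalization.count_roots
    (h : IsBlockDiagonalization A lam X₁ X₂ Y₁ Y₂ A₂₂) (hp : p ≤ n)
    (μ : EuclideanSpace ℂ (Fin d))
    (hsep : ¬ Module.End.HasEigenvalue (Matrix.toLin' (JointEig.matComb A₂₂ μ)) (eigComb lam μ)) :
    (JointEig.matComb A μ).charpoly.roots.count (eigComb lam μ) = p := by
  have h2 := not_mem_roots_of_not_hasEigenvalue hsep
  rw [h.charpoly_matComb hp μ, Polynomial.roots_mul, Multiset.count_add,
    Polynomial.roots_pow, Polynomial.roots_X_sub_C]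
  · rw [Multiset.count_nsmul, Multiset.count_singleton_self, Multiset.count_eq_zero.mpr]
    · simp
    · exact fun hm => h2 (Polynomial.isRoot_of_mem_roots hm)
  · exact mul_ne_zero (pow_ne_zero _ (X_sub_C_ne_zero _)) (Matrix.charpoly_monic _).ne_zero

lemma exists_left_right_inverse {m : ℕ} {M : Matrix (Fin m) (Fin m) ℂ} {z : ℂ}
    (hsep : ¬ Module.End.HasEigenvalue (Matrix.toLin' M) z) :
    ∃ N : Matrix (Fin m) (Fin m) ℂ, N * (M - z • 1) = 1 ∧ (M - z • 1) * N = 1 := by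
  have h : IsUnit (M - z • (1 : Matrix (Fin m) (Fin m) ℂ)) := by
    rw [Module.End.hasEigenvalue_iff_mem_spectrum, Matrix.spectrum_toLin', spectrum.mem_iff,
      not_not, Algebra.algebraMap_eq_smul_one] at hsep
    rw [← neg_sub]
    exact hsep.neg
  obtain ⟨u, hu⟩ := h
  exact ⟨(u⁻¹ : (Matrix (Fin m) (Fin m) ℂ)ˣ), by rw [← hu]; simp, by rw [← hu]; simp⟩

/-! ### First-order bounds for perturbed eigenvectors and eigenvalues -/

/-- Bound on the component `Y₂ᴴ x` of a right eigenvector of a perturbation of `A(μ)`. -/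
lemma IsBlockDiagonalization.norm_right_component_le
    (h : IsBlockDiagonalization A lam X₁ X₂ Y₁ Y₂ A₂₂) (hp : p ≤ n)
    (μ : EuclideanSpace ℂ (Fin d)) {N : Matrix (Fin (n - p)) (Fin (n - p)) ℂ}
    (hN : N * (JointEig.matComb A₂₂ μ - eigComb lam μ • 1) = 1)
    {F : Matrix (Fin n) (Fin n) ℂ} {x : Matrix (Fin n) Unit ℂ} {θ : ℂ}
    (hx : (JointEig.matComb A μ + F) * x = θ • x)
    (hθ : ‖N‖ * ‖θ - eigComb lam μ‖ ≤ 1 / 2) :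
    (JointEig.matComb A₂₂ μ - eigComb lam μ • 1) * (Y₂ᴴ * x) =
        (θ - eigComb lam μ) • (Y₂ᴴ * x) - Y₂ᴴ * (F * x) ∧
      ‖Y₂ᴴ * x‖ ≤ 2 * ‖N‖ * ‖Y₂‖ * ‖F‖ * ‖x‖ := by
  obtain ⟨h11, h12, h21, h22⟩ := h.dual_blocks
  have e1 : (JointEig.matComb A₂₂ μ - eigComb lam μ • 1) * (Y₂ᴴ * x) =
      (θ - eigComb lam μ) • (Y₂ᴴ * x) - Y₂ᴴ * (F * x) := by
    have e2 : Y₂ᴴ * JointEig.matComb A μ = JointEig.matComb A₂₂ μ * Y₂ᴴ := by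
      rw [h.matComb_eq_add hp μ, Matrix.mul_add, Matrix.mul_smul, ← Matrix.mul_assoc, h21,
        ← Matrix.mul_assoc, ← Matrix.mul_assoc, h22]
      simp
    have e3 := congrArg (Y₂ᴴ * ·) hx
    simp only [Matrix.add_mul, Matrix.mul_add, Matrix.mul_smul] at e3
    rw [← Matrix.mul_assoc, e2, Matrix.mul_assoc] at e3
    rw [Matrix.sub_mul, sub_smul, ← e3, Matrix.smul_mul, Matrix.one_mul]
    abel
  refine ⟨e1, ?_⟩
  have e4 : Y₂ᴴ * x = N * ((θ - eigComb lam μ) • (Y₂ᴴ * x) - Y₂ᴴ * (F * x)) := by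
    rw [← e1, ← Matrix.mul_assoc, hN, Matrix.one_mul]
  have e5 : ‖Y₂ᴴ * x‖ ≤ ‖N‖ * (‖θ - eigComb lam μ‖ * ‖Y₂ᴴ * x‖ + ‖Y₂‖ * (‖F‖ * ‖x‖)) := by
    conv_lhs => rw [e4]
    refine (Matrix.l2_opNorm_mul _ _).trans ?_
    gcongr
    refine (norm_sub_le _ _).trans ?_
    rw [norm_smul]
    gcongr
    refine (Matrix.l2_opNorm_mul _ _).trans ?_
    rw [Matrix.l2_opNorm_conjTranspose]
    gcongr
    exact Matrix.l2_opNorm_mul _ _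
  -- Half of the left side of `e5` is absorbed, which produces the factor `2`.
  have e6 : ‖N‖ * ‖θ - eigComb lam μ‖ * ‖Y₂ᴴ * x‖ ≤ 1 / 2 * ‖Y₂ᴴ * x‖ := by gcongr
  nlinarith [e5, e6]

/-- Bound on the component `X₂ᴴ y` of a left eigenvector of a perturbation of `A(μ)`. -/
lemma IsBlockDiagonalization.norm_left_component_le
    (h : IsBlockDiagonalization A lam X₁ X₂ Y₁ Y₂ A₂₂) (hp : p ≤ n)
    (μ : EuclideanSpace ℂ (Fin d)) {N : Matrix (Fin (n - p)) (Fin (n - p)) ℂ}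
    (hN : (JointEig.matComb A₂₂ μ - eigComb lam μ • 1) * N = 1)
    {F : Matrix (Fin n) (Fin n) ℂ} {y : Matrix (Fin n) Unit ℂ} {θ : ℂ}
    (hy : yᴴ * (JointEig.matComb A μ + F) = θ • yᴴ)
    (hθ : ‖N‖ * ‖θ - eigComb lam μ‖ ≤ 1 / 2) :
    ‖yᴴ * X₂‖ ≤ 2 * ‖N‖ * ‖X₂‖ * ‖F‖ * ‖y‖ := by
  obtain ⟨h11, h12, h21, h22⟩ := h.dual_blocks
  have e1 : (yᴴ * X₂) * (JointEig.matComb A₂₂ μ - eigComb lam μ • 1) =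
      (θ - eigComb lam μ) • (yᴴ * X₂) - (yᴴ * F) * X₂ := by
    have e2 : JointEig.matComb A μ * X₂ = X₂ * JointEig.matComb A₂₂ μ := by
      rw [h.matComb_eq_add hp μ, Matrix.add_mul, Matrix.smul_mul, Matrix.mul_assoc, h12,
        Matrix.mul_assoc, Matrix.mul_assoc, h22]
      simp
    have e3 := congrArg (· * X₂) hy
    simp only [Matrix.add_mul, Matrix.mul_add, Matrix.smul_mul] at e3
    rw [Matrix.mul_assoc, e2, ← Matrix.mul_assoc] at e3
    rw [Matrix.mul_sub, sub_smul, ← e3, Matrix.mul_smul, Matrix.mul_one]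
    abel
  have e4 : yᴴ * X₂ = ((θ - eigComb lam μ) • (yᴴ * X₂) - (yᴴ * F) * X₂) * N := by
    rw [← e1, Matrix.mul_assoc, hN, Matrix.mul_one]
  have e5 : ‖yᴴ * X₂‖ ≤ (‖θ - eigComb lam μ‖ * ‖yᴴ * X₂‖ + ‖y‖ * ‖F‖ * ‖X₂‖) * ‖N‖ := by
    conv_lhs => rw [e4]
    refine (Matrix.l2_opNorm_mul _ _).trans ?_
    gcongr
    refine (norm_sub_le _ _).trans ?_
    rw [norm_smul]
    gcongr
    refine (Matrix.l2_opNorm_mul _ _).trans ?_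
    gcongr
    rw [← Matrix.l2_opNorm_conjTranspose y]
    exact Matrix.l2_opNorm_mul _ _
  have e6 : ‖N‖ * ‖θ - eigComb lam μ‖ * ‖yᴴ * X₂‖ ≤ 1 / 2 * ‖yᴴ * X₂‖ := by gcongr
  nlinarith [e5, e6]

/-- The eigenvalue shift is of the order of the perturbation. -/
lemma IsBlockDiagonalization.norm_shift_le
    (h : IsBlockDiagonalization A lam X₁ X₂ Y₁ Y₂ A₂₂) (hp : p ≤ n)
    (μ : EuclideanSpace ℂ (Fin d))
    {F : Matrix (Fin n) (Fin n) ℂ} {x : Matrix (Fin n) Unit ℂ} {θ : ℂ}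
    (hx : (JointEig.matComb A μ + F) * x = θ • x) (hx1 : ‖x‖ = 1)
    (hb : ‖X₂‖ * ‖Y₂ᴴ * x‖ ≤ 1 / 2) :
    ‖θ - eigComb lam μ‖ ≤ 2 * ‖X₁‖ * ‖Y₁‖ * ‖F‖ := by
  obtain ⟨h11, h12, h21, h22⟩ := h.dual_blocks
  -- Testing with the unperturbed `Y₁`, not with `y`, keeps the bound independent of `‖y‖`.
  have e1 : (θ - eigComb lam μ) • (Y₁ᴴ * x) = Y₁ᴴ * (F * x) := by
    have e2 : Y₁ᴴ * JointEig.matComb A μ = eigComb lam μ • Y₁ᴴ := by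
      rw [h.matComb_eq_add hp μ, Matrix.mul_add, Matrix.mul_smul, ← Matrix.mul_assoc, h11,
        ← Matrix.mul_assoc, ← Matrix.mul_assoc, h12]
      simp
    have e3 := congrArg (Y₁ᴴ * ·) hx
    simp only [Matrix.add_mul, Matrix.mul_add, Matrix.mul_smul] at e3
    rw [← Matrix.mul_assoc, e2, Matrix.smul_mul] at e3
    rw [sub_smul, ← e3]
    abel
  have e4 : ‖θ - eigComb lam μ‖ * ‖Y₁ᴴ * x‖ ≤ ‖Y₁‖ * ‖F‖ := by
    rw [← norm_smul, e1]
    refine (Matrix.l2_opNorm_mul _ _).trans ?_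
    rw [Matrix.l2_opNorm_conjTranspose]
    gcongr
    refine (Matrix.l2_opNorm_mul _ _).trans ?_
    rw [hx1, mul_one]
  have e5 : (1 : ℝ) / 2 ≤ ‖X₁‖ * ‖Y₁ᴴ * x‖ := by
    have e6 : x = X₁ * (Y₁ᴴ * x) + X₂ * (Y₂ᴴ * x) := by
      rw [← Matrix.mul_assoc, ← Matrix.mul_assoc, ← Matrix.add_mul, h.sum_projections hp,
        Matrix.one_mul]
    have e7 : ‖x‖ ≤ ‖X₁‖ * ‖Y₁ᴴ * x‖ + ‖X₂‖ * ‖Y₂ᴴ * x‖ := by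
      conv_lhs => rw [e6]
      exact (norm_add_le _ _).trans (add_le_add (Matrix.l2_opNorm_mul _ _)
        (Matrix.l2_opNorm_mul _ _))
    linarith
  have e8 := mul_le_mul_of_nonneg_left e5 (norm_nonneg (θ - eigComb lam μ))
  have e9 := mul_le_mul_of_nonneg_left e4 (norm_nonneg X₁)
  linarith

end Block

end JointEig

/-! ### Vectors of sesquilinear forms and the trade-off for large `‖y‖` -/

namespace JointEig

lemma matComb_add_smul {n d : ℕ} (A E : Fin d → Matrix (Fin n) (Fin n) ℂ) (c : ℂ)
    (μ : EuclideanSpace ℂ (Fin d)) :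
    matComb (fun k => A k + c • E k) μ = matComb A μ + c • matComb E μ := by
  simp only [matComb, smul_add, Finset.sum_add_distrib, Finset.smul_sum, smul_comm c]

/-- The vector of the sesquilinear forms `y* E_k x`. -/
noncomputable def formVec {n d : ℕ} (E : Fin d → Matrix (Fin n) (Fin n) ℂ)
    (y x : Matrix (Fin n) Unit ℂ) : EuclideanSpace ℂ (Fin d) :=
  WithLp.toLp 2 fun k => (yᴴ * E k * x) () ()

lemma rq2_eq_formVec {n d p : ℕ} (E : Fin d → Matrix (Fin n) (Fin n) ℂ)
    (X Y : Matrix (Fin n) (Fin p) ℂ) (i : Fin p) :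
    rq2 E (colVec X i) (colVec Y i) = formVec E (col Y i) (col X i) := by
  ext k
  simp only [rq2, formVec, Matrix.mul_assoc]
  rfl

lemma rq1_eq_formVec {n d p : ℕ} (E : Fin d → Matrix (Fin n) (Fin n) ℂ)
    (X : Matrix (Fin n) (Fin p) ℂ) (i : Fin p) :
    rq1 E (colVec X i) = formVec E (col X i) (col X i) :=
  rq2_eq_formVec E X X i

lemma formVec_perturbation_sub {n d : ℕ} (A E : Fin d → Matrix (Fin n) (Fin n) ℂ)
    (lam : EuclideanSpace ℂ (Fin d)) (c : ℂ) {y x : Matrix (Fin n) Unit ℂ} (hyx : yᴴ * x = 1) :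
    formVec (fun k => A k + c • E k) y x - lam =
      formVec (fun k => A k - lam k • (1 : Matrix (Fin n) (Fin n) ℂ)) y x + c • formVec E y x := by
  ext k
  simp only [formVec, PiLp.sub_apply, PiLp.add_apply, PiLp.smul_apply, Matrix.mul_add,
    Matrix.add_mul, Matrix.mul_sub, Matrix.sub_mul, Matrix.mul_smul, Matrix.smul_mul,
    Matrix.mul_one, hyx, Matrix.add_apply, Matrix.sub_apply, Matrix.smul_apply, smul_eq_mul,
    Matrix.one_apply_eq]
  ring

lemma eigComb_formVec {n d : ℕ} (E : Fin d → Matrix (Fin n) (Fin n) ℂ)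
    (μ : EuclideanSpace ℂ (Fin d)) (y x : Matrix (Fin n) Unit ℂ) :
    eigComb (formVec E y x) μ = (yᴴ * matComb E μ * x) () () := by
  simp [eigComb, formVec, matComb, Matrix.mul_sum, Matrix.sum_mul, Matrix.sum_apply]

lemma norm_formVec_le_sum {n d : ℕ} (E : Fin d → Matrix (Fin n) (Fin n) ℂ)
    (y x : Matrix (Fin n) Unit ℂ) :
    ‖formVec E y x‖ ≤ ∑ k, ‖yᴴ * E k * x‖ := by
  simp only [norm_unit_matrix]
  rw [EuclideanSpace.norm_eq, Real.sqrt_le_left (Finset.sum_nonneg fun _ _ => norm_nonneg _)]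
  exact Finset.sum_sq_le_sq_sum_of_nonneg fun _ _ => norm_nonneg _

/-- Pythagoras: the subtracted matrix is the Frobenius-orthogonal projection of `E` onto the line of
`y xᴴ`, whose Frobenius norm is `‖y‖`. -/
lemma frobNorm_sq_sub_rankOne {n : ℕ} (E : Matrix (Fin n) (Fin n) ℂ)
    {y x : Matrix (Fin n) Unit ℂ} (hx : ‖x‖ = 1) (hy : 0 < ‖y‖) :
    frobNorm (E - ((yᴴ * E * x) () () / (‖y‖ : ℂ) ^ 2) • (y * xᴴ)) ^ 2 =
      frobNorm E ^ 2 - ‖(yᴴ * E * x) () ()‖ ^ 2 / ‖y‖ ^ 2 := by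
  set v := (yᴴ * E * x) () () with hv
  set c := v / (‖y‖ : ℂ) ^ 2 with hc
  have hsum : v = ∑ i, ∑ j, star (y i ()) * E i j * x j () := by
    rw [hv, Matrix.mul_apply]
    simp only [Matrix.mul_apply, Finset.sum_mul, Matrix.conjTranspose_apply]
    exact Finset.sum_comm
  have h1 : ∑ i, ∑ j, (E i j * star (c * (y i () * star (x j ())))).re = (star c * v).re := by
    rw [hsum, Finset.mul_sum, Complex.re_sum]
    refine Finset.sum_congr rfl fun i _ => ?_
    rw [Finset.mul_sum, Complex.re_sum]
    refine Finset.sum_congr rfl fun j _ => ?_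
    congr 1
    simp only [star_mul', star_star]
    ring
  have h2 : ∑ i, ∑ j, ‖c * (y i () * star (x j ()))‖ ^ 2 = ‖c‖ ^ 2 * ‖y‖ ^ 2 := by
    calc _ = ‖c‖ ^ 2 * (∑ i, ‖y i ()‖ ^ 2) * ∑ j, ‖x j ()‖ ^ 2 := by
          simp only [norm_mul, norm_star, mul_pow, Finset.mul_sum, Finset.sum_mul, ← mul_assoc]
          exact Finset.sum_comm
      _ = _ := by rw [← norm_sq_column, ← norm_sq_column, hx]; ring
  have hcn : ‖c‖ = ‖v‖ / ‖y‖ ^ 2 := by rw [hc]; simp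
  have h3 : (star c * v).re = ‖v‖ ^ 2 / ‖y‖ ^ 2 := by
    have : star c * v = ((‖v‖ ^ 2 / ‖y‖ ^ 2 : ℝ) : ℂ) := by
      rw [hc]
      simp only [star_div₀, star_pow, Complex.star_def, Complex.conj_ofReal]
      push_cast
      rw [← Complex.conj_mul', div_mul_eq_mul_div]
    rw [this, Complex.ofReal_re]
  have h4 : ∀ i j, ‖(E - c • (y * xᴴ)) i j‖ ^ 2 = ‖E i j‖ ^ 2 -
      2 * (E i j * star (c * (y i () * star (x j ())))).re +
        ‖c * (y i () * star (x j ()))‖ ^ 2 := by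
    intro i j
    have : (E - c • (y * xᴴ)) i j = E i j - c * (y i () * star (x j ())) := by
      simp [Matrix.mul_apply]
    rw [this, ← Complex.normSq_eq_norm_sq, Complex.normSq_sub, Complex.normSq_eq_norm_sq,
      Complex.normSq_eq_norm_sq, Complex.star_def]
    ring
  rw [frobNorm_sq, frobNorm_sq]
  simp only [h4, Finset.sum_add_distrib, Finset.sum_sub_distrib, ← Finset.mul_sum, h1, h2, h3,
    hcn]
  field_simp
  ring

/-- If the forms `y* E_k x` are close to their maximum, then `E(μ)` is close to the rank one matrix
`(y* E(μ) x) y x* / ‖y‖²`. -/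
lemma norm_formVec_le_and_norm_matComb_le {n d : ℕ} (E : Fin d → Matrix (Fin n) (Fin n) ℂ)
    (hE : ∑ k, frobNorm (E k) ^ 2 = 1) {μ : EuclideanSpace ℂ (Fin d)} (hμ : ‖μ‖ = 1)
    {y x : Matrix (Fin n) Unit ℂ} (hx : ‖x‖ = 1) (hy : 0 < ‖y‖) :
    ‖formVec E y x‖ ^ 2 / ‖y‖ ^ 2 ≤ 1 ∧
    ‖matComb E μ‖ ≤ ‖(yᴴ * matComb E μ * x) () ()‖ / ‖y‖ +
      √(1 - ‖formVec E y x‖ ^ 2 / ‖y‖ ^ 2) := by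
  set G : Fin d → Matrix (Fin n) (Fin n) ℂ :=
    fun k => E k - ((yᴴ * E k * x) () () / (‖y‖ : ℂ) ^ 2) • (y * xᴴ) with hG
  have hGs : ∑ k, frobNorm (G k) ^ 2 = 1 - ‖formVec E y x‖ ^ 2 / ‖y‖ ^ 2 := by
    simp only [hG, frobNorm_sq_sub_rankOne _ hx hy, Finset.sum_sub_distrib, hE,
      EuclideanSpace.norm_sq_eq, Finset.sum_div]
    rfl
  refine ⟨?_, ?_⟩
  · have : 0 ≤ ∑ k, frobNorm (G k) ^ 2 := Finset.sum_nonneg fun _ _ => sq_nonneg _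
    linarith
  -- The projections onto `y xᴴ` add up linearly over `k`; Cauchy–Schwarz bounds the remainder
  -- `G(μ)` by the total Frobenius mass left after projection.
  have hdec : matComb E μ =
      ((yᴴ * matComb E μ * x) () () / (‖y‖ : ℂ) ^ 2) • (y * xᴴ) + matComb G μ := by
    rw [← eigComb_formVec]
    simp only [matComb, hG, smul_sub, Finset.sum_sub_distrib, smul_smul, ← Finset.sum_smul,
      eigComb, Finset.sum_div, formVec, mul_div_assoc]
    abel
  have hG' := norm_matComb_le G μ
  rw [hGs, hμ, one_mul] at hG'
  conv_lhs => rw [hdec]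
  refine (norm_add_le _ _).trans (add_le_add ?_ hG')
  have hyx : ‖y * xᴴ‖ ≤ ‖y‖ := by
    refine (Matrix.l2_opNorm_mul _ _).trans ?_
    rw [Matrix.l2_opNorm_conjTranspose, hx, mul_one]
  rw [norm_smul]
  calc _ ≤ ‖(yᴴ * matComb E μ * x) () () / (‖y‖ : ℂ) ^ 2‖ * ‖y‖ := by gcongr
    _ = _ := by
      simp only [norm_div, norm_pow, Complex.norm_real, norm_norm]
      field_simp

/-- The scalar inequality behind the bound for two-sided Rayleigh quotients. -/
lemma two_sided_scalar_bound {ε N V s η β K Q q : ℝ} (hε : 0 < ε) (hN : 1 ≤ N)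
    (hs : 0 ≤ s) (hVs : s ^ 2 = 1 - V ^ 2 / N ^ 2) (hη : 0 ≤ η) (hη1 : η ≤ 1) (hβ0 : 0 ≤ β)
    (hβ : β ≤ η + s) (hK : 0 ≤ K) (hQ : 0 ≤ Q) (hq : q ≤ Q * ε ^ 2 * β ^ 2 * N)
    (hh : ε * (η * N) ≤ K * ε + Q * ε ^ 2 * β ^ 2 * N) (hεQ : 12 * (Q * ε) ≤ 1) :
    q + ε * V ≤ N * ε + 16 * Q * K ^ 2 * ε ^ 2 := by
  have hN0 : 0 < N := by linarith
  set t := Q * ε with ht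
  have ht0 : 0 ≤ t := by positivity
  have hs1 : s ^ 2 ≤ 1 := by
    have : 0 ≤ V ^ 2 / N ^ 2 := by positivity
    linarith
  have hβ2 : β ^ 2 ≤ 2 * (η ^ 2 + s ^ 2) := by
    have : β ^ 2 ≤ (η + s) ^ 2 := by gcongr
    nlinarith [sq_nonneg (η - s)]
  have hη2 : η ^ 2 ≤ η := by nlinarith
  have h1 : η * N ≤ K + t * β ^ 2 * N := by
    have : ε * (η * N) ≤ ε * (K + t * β ^ 2 * N) := by rw [ht]; linarith
    exact le_of_mul_le_mul_left this hε
  set k := K / N with hk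
  have hk0 : 0 ≤ k := by positivity
  have h2 : η ≤ k + t * β ^ 2 := by
    rw [hk, div_add' _ _ _ hN0.ne', le_div_iff₀ hN0]
    exact h1
  -- As `η ≤ 1`, `β² ≤ 2 (η + s²)`, and `t ≤ 1/12` lets the resulting `2 t η` be absorbed on the
  -- left.
  have h3 : η ≤ 2 * k + 4 * t * s ^ 2 := by
    have e1 : t * β ^ 2 ≤ t * (2 * (η + s ^ 2)) :=
      mul_le_mul_of_nonneg_left (by linarith) ht0
    have e2 : t * η ≤ 1 / 12 * η := by
      have : t ≤ 1 / 12 := by linarith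
      gcongr
    have e3 : 0 ≤ t * s ^ 2 := by positivity
    nlinarith
  have h4 : 4 * t * s ^ 2 ≤ s := by
    have : s ≤ 1 := by nlinarith
    have e1 : t * s ^ 2 ≤ 1 / 12 * s ^ 2 := by
      have : t ≤ 1 / 12 := by linarith
      gcongr
    nlinarith
  have h5 : η ^ 2 ≤ 8 * k ^ 2 + 2 * s ^ 2 := by
    have e1 : η ≤ 2 * k + s := h3.trans (by linarith)
    have e2 : η ^ 2 ≤ (2 * k + s) ^ 2 := by gcongr
    nlinarith [sq_nonneg (2 * k - s)]
  have h6 : β ^ 2 ≤ 16 * k ^ 2 + 6 * s ^ 2 := by linarith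
  have h7 : V ≤ N * (1 - s ^ 2 / 2) := by
    have e1 : V ^ 2 = N ^ 2 * (1 - s ^ 2) := by
      rw [hVs]; field_simp; ring
    have e2 : V ^ 2 ≤ (N * (1 - s ^ 2 / 2)) ^ 2 := by
      rw [e1, mul_pow]
      gcongr
      nlinarith [sq_nonneg (s ^ 2)]
    have e3 : 0 ≤ N * (1 - s ^ 2 / 2) := mul_nonneg hN0.le (by linarith)
    exact abs_le_of_sq_le_sq' e2 e3 |>.2
  have h8 : q ≤ t * ε * (16 * k ^ 2 + 6 * s ^ 2) * N := by
    refine hq.trans ?_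
    have : Q * ε ^ 2 * β ^ 2 * N = t * ε * β ^ 2 * N := by rw [ht]; ring
    rw [this]
    gcongr
  -- Here `N ≥ 1` removes the dependence on the size of `y`.
  have h9 : k ^ 2 * N ≤ K ^ 2 := by
    have e1 : k * N = K := by rw [hk]; field_simp
    have e2 : k ≤ K := div_le_self hK hN
    calc k ^ 2 * N = k * (k * N) := by ring
      _ ≤ K * K := by rw [e1]; gcongr
      _ = K ^ 2 := by ring
  -- The `s²` part of `q` is paid for by the shortfall in `h7`; this fixes the constant `12` in
  -- `hεQ`.
  have h10 : t * ε * 6 * s ^ 2 * N ≤ ε * N * s ^ 2 / 2 := by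
    have e1 : 0 ≤ ε * N * s ^ 2 := by positivity
    have e2 := mul_le_mul_of_nonneg_right hεQ e1
    linarith
  have h11 : ε * V ≤ ε * (N * (1 - s ^ 2 / 2)) := by gcongr
  have h12 : t * ε * 16 * (k ^ 2 * N) ≤ t * ε * 16 * K ^ 2 := by gcongr
  have h13 : t * ε * 16 * K ^ 2 = 16 * Q * K ^ 2 * ε ^ 2 := by rw [ht]; ring
  linarith

end JointEig

/-! ### Uniform perturbation estimates and the two-sided bound -/

namespace JointEig

section Perturbation

variable {n d p : ℕ} {A : Fin d → Matrix (Fin n) (Fin n) ℂ} {lam : EuclideanSpace ℂ (Fin d)}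
  {X₁ : Matrix (Fin n) (Fin p) ℂ} {X₂ : Matrix (Fin n) (Fin (n - p)) ℂ}
  {Y₁ : Matrix (Fin n) (Fin p) ℂ} {Y₂ : Matrix (Fin n) (Fin (n - p)) ℂ}
  {A₂₂ : Fin d → Matrix (Fin (n - p)) (Fin (n - p)) ℂ} {μ : EuclideanSpace ℂ (Fin d)}

/-- The estimates for an eigenvector pair of the perturbed matrix `A(μ) + ε E(μ)`. -/
structure IsPerturbedPair (A : Fin d → Matrix (Fin n) (Fin n) ℂ)
    (lam : EuclideanSpace ℂ (Fin d)) (X₂ Y₂ : Matrix (Fin n) (Fin (n - p)) ℂ)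
    (A₂₂ : Fin d → Matrix (Fin (n - p)) (Fin (n - p)) ℂ) (μ : EuclideanSpace ℂ (Fin d))
    (K L : ℝ) (E : Fin d → Matrix (Fin n) (Fin n) ℂ) (ε : ℝ)
    (x y : Matrix (Fin n) Unit ℂ) (θ : ℂ) : Prop where
  norm_right : ‖x‖ = 1
  dual : yᴴ * x = 1
  right_eq : (matComb A μ + (ε : ℂ) • matComb E μ) * x = θ • x
  component_eq : (matComb A₂₂ μ - eigComb lam μ • 1) * (Y₂ᴴ * x) =
    (θ - eigComb lam μ) • (Y₂ᴴ * x) - Y₂ᴴ * (((ε : ℂ) • matComb E μ) * x)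
  right_le : ‖Y₂ᴴ * x‖ ≤ L * ε * ‖matComb E μ‖
  left_le : ‖yᴴ * X₂‖ ≤ L * ε * ‖matComb E μ‖ * ‖y‖
  shift_le : ‖θ - eigComb lam μ‖ ≤ K * ε

lemma norm_matComb_le_one {E : Fin d → Matrix (Fin n) (Fin n) ℂ}
    (hE : ∑ k, frobNorm (E k) ^ 2 = 1) (hμ : ‖μ‖ = 1) : ‖matComb E μ‖ ≤ 1 := by
  have h := norm_matComb_le E μ
  rwa [hE, hμ, Real.sqrt_one, one_mul] at h

lemma mul_col_eq_smul {B : Matrix (Fin n) (Fin n) ℂ} {X : Matrix (Fin n) (Fin p) ℂ} {i : Fin p}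
    {θ : ℂ} (h : B *ᵥ (fun a => X a i) = θ • (fun a => X a i)) : B * col X i = θ • col X i := by
  ext a _
  exact congrFun h a

lemma conjTranspose_col_mul_eq_smul {B : Matrix (Fin n) (Fin n) ℂ}
    {Y : Matrix (Fin n) (Fin p) ℂ} {i : Fin p} {θ : ℂ}
    (h : (fun a => star (Y a i)) ᵥ* B = θ • (fun a => star (Y a i))) :
    (col Y i)ᴴ * B = θ • (col Y i)ᴴ := by
  ext _ a
  exact congrFun h a

lemma conjTranspose_col_mul_col {X Y : Matrix (Fin n) (Fin p) ℂ} (h : Yᴴ * X = 1) (i : Fin p) :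
    (col Y i)ᴴ * col X i = 1 := by
  ext _ _
  have h1 := congrFun (congrFun h i) i
  rw [Matrix.one_apply_eq] at h1 ⊢
  exact h1

/-- For all small `ε`, the eigenvector pairs of the closest eigenvalues satisfy the perturbation
estimates with constants that do not depend on the perturbation. -/
lemma IsBlockDiagonalization.exists_isPerturbedPair
    (h : IsBlockDiagonalization A lam X₁ X₂ Y₁ Y₂ A₂₂) (hp : p ≤ n) (hμ : ‖μ‖ = 1)
    (hsep : ¬ Module.End.HasEigenvalue (Matrix.toLin' (JointEig.matComb A₂₂ μ)) (eigComb lam μ)) :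
    ∃ K L δ : ℝ, 0 ≤ K ∧ 0 ≤ L ∧ 0 < δ ∧
      ∀ E : Fin d → Matrix (Fin n) (Fin n) ℂ, ∑ k, frobNorm (E k) ^ 2 = 1 →
      ∀ ε : ℝ, 0 < ε → ε < δ →
      ∀ Xt Yt : Matrix (Fin n) (Fin p) ℂ,
        IsClosestEigenbasis (JointEig.matComb (fun k => A k + (ε : ℂ) • E k) μ)
          (eigComb lam μ) Xt Yt →
        ∀ i : Fin p, ∃ θ : ℂ,
          IsPerturbedPair A lam X₂ Y₂ A₂₂ μ K L E ε (col Xt i) (col Yt i) θ := by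
  obtain ⟨N, hN1, hN2⟩ := exists_left_right_inverse hsep
  -- The radius is chosen so that `‖N‖ |θ - λ(μ)| ≤ 1/2`. The second entry of the minimum below
  -- ensures `‖X₂‖ ‖Y₂ᴴ x‖ ≤ 1/2`; the `+ 1`s avoid division by zero.
  obtain ⟨δ₁, hδ₁, hroots⟩ := exists_forall_le_countP_roots (JointEig.matComb A μ)
    (eigComb lam μ) (h.count_roots hp μ hsep).ge (r := 1 / (2 * (‖N‖ + 1))) (by positivity)
  set D : ℝ := ‖X₂‖ * (2 * ‖N‖ * ‖Y₂‖) with hD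
  have hD0 : D + 1 ≠ 0 := by positivity
  refine ⟨2 * ‖X₁‖ * ‖Y₁‖, 2 * ‖N‖ * (‖X₂‖ + ‖Y₂‖), min δ₁ (1 / (2 * (D + 1))), by positivity,
    by positivity, by positivity, ?_⟩
  intro E hE ε hε hεδ Xt Yt hXt i
  obtain ⟨θ, ⟨R, hR1, hR2⟩, -, hxe, hye, hYX, hXn⟩ := hXt
  have hE1 := norm_matComb_le_one hE hμ
  have hEε : ‖(ε : ℂ) • JointEig.matComb E μ‖ = ε * ‖JointEig.matComb E μ‖ := by
    rw [norm_smul, Complex.norm_real, Real.norm_of_nonneg hε.le]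
  have hEε1 : ‖(ε : ℂ) • JointEig.matComb E μ‖ ≤ ε := by
    rw [hEε]
    exact mul_le_of_le_one_right hε.le hE1
  have hB := matComb_add_smul A E ε μ
  have hx1 : ‖col Xt i‖ = 1 := by rw [norm_col, hXn]
  have hx := mul_col_eq_smul (hxe i)
  have hy := conjTranspose_col_mul_eq_smul (hye i)
  have hθ : ‖θ i - eigComb lam μ‖ < 1 / (2 * (‖N‖ + 1)) := by
    refine IsClosestEigenbasis.eigenvalues_near hR1 hR2 (hroots _ ?_) i
    rw [hB, add_sub_cancel_left]
    exact hEε1.trans_lt (hεδ.trans_le (min_le_left _ _))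
  rw [hB] at hx hy
  have hθN : ‖N‖ * ‖θ i - eigComb lam μ‖ ≤ 1 / 2 := by
    calc _ ≤ (‖N‖ + 1) * (1 / (2 * (‖N‖ + 1))) := by gcongr; linarith
      _ = 1 / 2 := by field_simp
  obtain ⟨hc, hr⟩ := h.norm_right_component_le hp μ hN1 hx hθN
  have hl := h.norm_left_component_le hp μ hN2 hy hθN
  rw [hx1, mul_one] at hr
  have hDε : D * ε ≤ 1 / 2 := by
    calc D * ε ≤ (D + 1) * (1 / (2 * (D + 1))) := by
          gcongr
          · linarith
          · exact hεδ.le.trans (min_le_right _ _)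
      _ = 1 / 2 := by field_simp
  have hb : ‖X₂‖ * ‖Y₂ᴴ * col Xt i‖ ≤ 1 / 2 := by
    calc _ ≤ ‖X₂‖ * (2 * ‖N‖ * ‖Y₂‖ * ε) := by grw [hr, hEε1]
      _ = D * ε := by rw [hD]; ring
      _ ≤ 1 / 2 := hDε
  have hs := h.norm_shift_le hp μ hx hx1 hb
  refine ⟨θ i, hx1, conjTranspose_col_mul_col hYX i, hx, hc, hr.trans ?_, hl.trans ?_,
    hs.trans ?_⟩
  -- The factor `‖E(μ)‖` is kept rather than bounded by `1`: the two-sided estimate needs its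
  -- square.
  · rw [hEε, mul_assoc _ ε]
    refine mul_le_mul_of_nonneg_right ?_ (by positivity)
    refine mul_le_mul_of_nonneg_left ?_ (by positivity)
    linarith [norm_nonneg X₂]
  · rw [hEε, mul_assoc _ ε]
    refine mul_le_mul_of_nonneg_right (mul_le_mul_of_nonneg_right ?_ (by positivity))
      (norm_nonneg _)
    refine mul_le_mul_of_nonneg_left ?_ (by positivity)
    linarith [norm_nonneg Y₂]
  · gcongr

lemma eigComb_add (v w μ : EuclideanSpace ℂ (Fin d)) :
    eigComb (v + w) μ = eigComb v μ + eigComb w μ := by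
  simp [eigComb, mul_add, Finset.sum_add_distrib]

lemma eigComb_sub (v w μ : EuclideanSpace ℂ (Fin d)) :
    eigComb (v - w) μ = eigComb v μ - eigComb w μ := by
  simp [eigComb, mul_sub]

lemma eigComb_smul (c : ℂ) (v μ : EuclideanSpace ℂ (Fin d)) :
    eigComb (c • v) μ = c * eigComb v μ := by
  simp only [eigComb, PiLp.smul_apply, smul_eq_mul, Finset.mul_sum]
  exact Finset.sum_congr rfl fun k _ => by ring

lemma one_le_norm_left {x y : Matrix (Fin n) Unit ℂ} (hx : ‖x‖ = 1) (hyx : yᴴ * x = 1) :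
    1 ≤ ‖y‖ := by
  have h := Matrix.l2_opNorm_mul yᴴ x
  rw [hyx, Matrix.l2_opNorm_conjTranspose, hx, mul_one, norm_unit_matrix, Matrix.one_apply_eq,
    norm_one] at h
  exact h

lemma IsPerturbedPair.two_sided_le (h : IsBlockDiagonalization A lam X₁ X₂ Y₁ Y₂ A₂₂)
    (hp : p ≤ n) (hμ : ‖μ‖ = 1) {K L : ℝ} (hK : 0 ≤ K) (hL : 0 ≤ L)
    {E : Fin d → Matrix (Fin n) (Fin n) ℂ} (hE : ∑ k, frobNorm (E k) ^ 2 = 1) {ε : ℝ} (hε : 0 < ε)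
    {x y : Matrix (Fin n) Unit ℂ} {θ : ℂ}
    (hxy : IsPerturbedPair A lam X₂ Y₂ A₂₂ μ K L E ε x y θ) {Q : ℝ}
    (hQ : Q = (∑ k, ‖A₂₂ k - lam k • (1 : Matrix (Fin (n - p)) (Fin (n - p)) ℂ)‖) * L ^ 2)
    (hεQ : 12 * (Q * ε) ≤ 1) :
    ‖formVec (fun k => A k + (ε : ℂ) • E k) y x - lam‖ ≤
      ‖y‖ * ε + 16 * Q * K ^ 2 * ε ^ 2 := by
  have hE1 := norm_matComb_le_one hE hμ
  have hy1 := one_le_norm_left hxy.norm_right hxy.dual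
  have hy0 : 0 < ‖y‖ := by linarith
  have hQ0 : 0 ≤ Q := by rw [hQ]; positivity
  set q := formVec (fun k => A k - lam k • (1 : Matrix (Fin n) (Fin n) ℂ)) y x with hqdef
  have hsub := formVec_perturbation_sub A E lam ε hxy.dual
  rw [← hqdef] at hsub
  have hq : ‖q‖ ≤ Q * ε ^ 2 * ‖matComb E μ‖ ^ 2 * ‖y‖ := by
    refine (norm_formVec_le_sum _ _ _).trans ?_
    calc _ ≤ ∑ k, ‖A₂₂ k - lam k • (1 : Matrix (Fin (n - p)) (Fin (n - p)) ℂ)‖ *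
          ((L * ε * ‖matComb E μ‖ * ‖y‖) * (L * ε * ‖matComb E μ‖)) := by
          refine Finset.sum_le_sum fun k _ => ?_
          have e : yᴴ * (A k - lam k • (1 : Matrix (Fin n) (Fin n) ℂ)) * x =
              (yᴴ * X₂) * ((A₂₂ k - lam k • (1 : Matrix (Fin (n - p)) (Fin (n - p)) ℂ)) *
                (Y₂ᴴ * x)) := by
            rw [h.sub_smul_one hp k]
            simp only [Matrix.mul_assoc]
          rw [e]
          refine (Matrix.l2_opNorm_mul _ _).trans ?_
          refine (mul_le_mul_of_nonneg_left (Matrix.l2_opNorm_mul _ _) (norm_nonneg _)).trans ?_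
          rw [mul_left_comm]
          gcongr
          · exact hxy.left_le
          · exact hxy.right_le
      _ = _ := by rw [← Finset.sum_mul, hQ]; ring
  -- Contracting the error vector with `μ` gives the eigenvalue shift, since `x` is an eigenvector
  -- of the perturbed `A(μ)` and `yᴴ x = 1`. This is what limits `yᴴ E(μ) x`.
  have hshift : eigComb q μ + ε * eigComb (formVec E y x) μ = θ - eigComb lam μ := by
    rw [← eigComb_smul, ← eigComb_add, ← hsub, eigComb_sub, eigComb_formVec, matComb_add_smul,
      Matrix.mul_assoc, hxy.right_eq, Matrix.mul_smul, hxy.dual]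
    simp
  obtain ⟨hV, hβ⟩ := norm_formVec_le_and_norm_matComb_le E hE hμ hxy.norm_right hy0
  rw [← eigComb_formVec] at hβ
  have hη : ‖eigComb (formVec E y x) μ‖ / ‖y‖ ≤ 1 := by
    rw [div_le_one hy0]
    refine (norm_eigComb_le _ _).trans ?_
    rw [hμ, one_mul]
    rw [← div_pow] at hV
    have := (sq_le_one_iff₀ (by positivity)).mp hV
    rwa [div_le_one hy0] at this
  have hh : ε * (‖eigComb (formVec E y x) μ‖ / ‖y‖ * ‖y‖) ≤
      K * ε + Q * ε ^ 2 * ‖matComb E μ‖ ^ 2 * ‖y‖ := by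
    rw [div_mul_cancel₀ _ hy0.ne']
    have e1 : (ε : ℂ) * eigComb (formVec E y x) μ = (θ - eigComb lam μ) - eigComb q μ := by
      rw [← hshift]; ring
    calc ε * ‖eigComb (formVec E y x) μ‖ = ‖(ε : ℂ) * eigComb (formVec E y x) μ‖ := by
          rw [norm_mul, Complex.norm_real, Real.norm_of_nonneg hε.le]
      _ ≤ ‖θ - eigComb lam μ‖ + ‖eigComb q μ‖ := by rw [e1]; exact norm_sub_le _ _
      _ ≤ _ := by
        refine add_le_add hxy.shift_le (((norm_eigComb_le _ _).trans_eq ?_).trans hq)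
        rw [hμ, one_mul]
  have hfin := two_sided_scalar_bound hε hy1 (Real.sqrt_nonneg _)
    (Real.sq_sqrt (by linarith)) (by positivity) hη (norm_nonneg _) hβ hK hQ0 hq hh hεQ
  rw [hsub]
  refine (norm_add_le _ _).trans ?_
  rwa [norm_smul, Complex.norm_real, Real.norm_of_nonneg hε.le]

end Perturbation

end JointEig

/-! ### The diagonalizable case and the one-sided bound -/

namespace JointEig

section Diagonal

variable {n d p : ℕ} {A : Fin d → Matrix (Fin n) (Fin n) ℂ}
  {Λ : Fin n → EuclideanSpace ℂ (Fin d)} {lam : EuclideanSpace ℂ (Fin d)}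
  {X₁ : Matrix (Fin n) (Fin p) ℂ} {X₂ : Matrix (Fin n) (Fin (n - p)) ℂ}
  {Y₁ : Matrix (Fin n) (Fin p) ℂ} {Y₂ : Matrix (Fin n) (Fin (n - p)) ℂ}
  {A₂₂ : Fin d → Matrix (Fin (n - p)) (Fin (n - p)) ℂ} {μ : EuclideanSpace ℂ (Fin d)}

/-- The `d`-tuple of the `j`-th diagonal entries. -/
def diagTuple {m d : ℕ} (M : Fin d → Matrix (Fin m) (Fin m) ℂ) (j : Fin m) :
    EuclideanSpace ℂ (Fin d) :=
  WithLp.toLp 2 fun k => M k j j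

lemma matComb_apply_diag {m d : ℕ} (M : Fin d → Matrix (Fin m) (Fin m) ℂ)
    (μ : EuclideanSpace ℂ (Fin d)) (j : Fin m) :
    matComb M μ j j = eigComb (diagTuple M j) μ := by
  simp [matComb, eigComb, diagTuple, Matrix.sum_apply]

/-- A common eigenvector belongs to one of the joint eigenvalues. -/
lemma IsJointEigenvalueList.exists_eq_of_common_eigenvector (hΛ : IsJointEigenvalueList A Λ)
    {x : Fin n → ℂ} (hx : x ≠ 0) {τ : EuclideanSpace ℂ (Fin d)}
    (hτ : ∀ k, A k *ᵥ x = τ k • x) : ∃ i, Λ i = τ := by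
  obtain ⟨U, hU, htri, hdiag⟩ := hΛ
  have hUU : U * Uᴴ = 1 := Matrix.mem_unitaryGroup_iff.mp hU
  set v := Uᴴ *ᵥ x with hv
  have hUv : U *ᵥ v = x := by rw [hv, Matrix.mulVec_mulVec, hUU, Matrix.one_mulVec]
  have hv0 : v ≠ 0 := by
    intro h0
    rw [h0, Matrix.mulVec_zero] at hUv
    exact hx hUv.symm
  obtain ⟨i₀, hi₀⟩ := Function.ne_iff.mp hv0
  -- At the last nonzero coordinate of `v`, an upper triangular matrix acts by its diagonal entry
  -- alone, and this index serves every `k`.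
  obtain ⟨i, hi, hmax⟩ := (Finset.univ.filter fun i => v i ≠ 0).exists_maximal
    ⟨i₀, by simpa using hi₀⟩
  have hvi : v i ≠ 0 := by simpa using hi
  have hlt : ∀ j, i < j → v j = 0 := by
    intro j hij
    by_contra hj
    exact absurd (hmax (by simpa using hj) hij.le) (not_le.mpr hij)
  refine ⟨i, ?_⟩
  ext k
  rw [hdiag i k]
  have h1 : (Uᴴ * A k * U) *ᵥ v = τ k • v := by
    rw [← Matrix.mulVec_mulVec, hUv, ← Matrix.mulVec_mulVec, hτ, Matrix.mulVec_smul]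
  have h2 := congrFun h1 i
  rw [Matrix.mulVec, dotProduct, Finset.sum_eq_single i] at h2
  · exact mul_right_cancel₀ hvi h2
  · intro j _ hji
    rcases lt_or_gt_of_ne hji with hj | hj
    · rw [htri k hj, zero_mul]
    · rw [hlt j hj, mul_zero]
  · simp

open Polynomial in
lemma IsJointEigenvalueList.roots_charpoly_matComb (hΛ : IsJointEigenvalueList A Λ)
    (μ : EuclideanSpace ℂ (Fin d)) :
    (matComb A μ).charpoly.roots = Finset.univ.val.map fun i => eigComb (Λ i) μ := by
  obtain ⟨U, hU, htri, hdiag⟩ := hΛ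
  have hUU : U * Uᴴ = 1 := Matrix.mem_unitaryGroup_iff.mp hU
  have hexp : Uᴴ * matComb A μ * U = ∑ k, μ k • (Uᴴ * A k * U) := by
    simp only [matComb, Matrix.mul_sum, Matrix.sum_mul, Matrix.mul_smul, Matrix.smul_mul]
  have hT : (Uᴴ * matComb A μ * U).IsUpperTriangular := by
    rw [hexp]
    intro i j hij
    rw [Matrix.sum_apply]
    refine Finset.sum_eq_zero fun k _ => ?_
    rw [Matrix.smul_apply, htri k hij, smul_zero]
  have hc : (matComb A μ).charpoly = (Uᴴ * matComb A μ * U).charpoly := by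
    rw [Matrix.charpoly_mul_comm, ← Matrix.mul_assoc, hUU, Matrix.one_mul]
  have hd : ∀ i, (Uᴴ * matComb A μ * U) i i = eigComb (Λ i) μ := by
    intro i
    simp [hexp, Matrix.sum_apply, eigComb, hdiag]
  rw [hc, Matrix.charpoly_of_isUpperTriangular _ hT, Polynomial.roots_prod _ _
    (Finset.prod_ne_zero_iff.mpr fun i _ => Polynomial.X_sub_C_ne_zero _)]
  simp [hd]

/-- If `λ(μ)` is not an eigenvalue of `A₂₂(μ)`, then it is separated from `λ⁽ʲ⁾(μ)` for all other
joint eigenvalues. -/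
lemma IsBlockDiagonalization.eigComb_ne (h : IsBlockDiagonalization A lam X₁ X₂ Y₁ Y₂ A₂₂)
    (hp : p ≤ n) (hΛ : IsJointEigenvalueList A Λ) (hmult : algMultiplicity Λ lam = p)
    (hsep : ¬ Module.End.HasEigenvalue (Matrix.toLin' (JointEig.matComb A₂₂ μ)) (eigComb lam μ))
    {i : Fin n} (hi : Λ i ≠ lam) : eigComb (Λ i) μ ≠ eigComb lam μ := by
  classical
  have h1 := h.count_roots hp μ hsep
  rw [hΛ.roots_charpoly_matComb μ, Multiset.count_map] at h1
  have h2 : (Finset.univ.filter fun i => eigComb lam μ = eigComb (Λ i) μ).card = p := h1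
  have h3 : (Finset.univ.filter fun i => Λ i = lam).card = p := by
    rw [← hmult, algMultiplicity, Nat.card_eq_fintype_card, Fintype.card_subtype]
  -- The left set is contained in the right one and both have `p` elements.
  have h4 : (Finset.univ.filter fun i => Λ i = lam) =
      Finset.univ.filter fun i => eigComb lam μ = eigComb (Λ i) μ := by
    refine Finset.eq_of_subset_of_card_le (fun j hj => ?_) (by rw [h2, h3])
    simp only [Finset.mem_filter, Finset.mem_univ, true_and] at hj ⊢
    rw [hj]
  intro hcon
  have h5 : i ∈ Finset.univ.filter fun i => Λ i = lam := by
    rw [h4]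
    simpa using hcon.symm
  exact hi (by simpa using h5)

lemma eigGap_nonneg (Λ : Fin n → EuclideanSpace ℂ (Fin d)) (lam μ : EuclideanSpace ℂ (Fin d)) :
    0 ≤ eigGap Λ lam μ := by
  refine Real.sInf_nonneg ?_
  rintro _ ⟨j, -, rfl⟩
  positivity

/-- In quotient form the bound also covers `Λ i = lam`, including the case where no other joint
eigenvalue exists and `eigGap` is `sInf ∅ = 0`. -/
lemma IsBlockDiagonalization.norm_sub_le_div_eigGap
    (h : IsBlockDiagonalization A lam X₁ X₂ Y₁ Y₂ A₂₂)
    (hp : p ≤ n) (hΛ : IsJointEigenvalueList A Λ) (hmult : algMultiplicity Λ lam = p)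
    (hsep : ¬ Module.End.HasEigenvalue (Matrix.toLin' (JointEig.matComb A₂₂ μ)) (eigComb lam μ))
    (i : Fin n) :
    ‖Λ i - lam‖ ≤ ‖eigComb (Λ i) μ - eigComb lam μ‖ / eigGap Λ lam μ := by
  rcases eq_or_ne (Λ i) lam with hi | hi
  · simp [hi]
  set S := (fun j => ‖eigComb (Λ j) μ - eigComb lam μ‖ / ‖Λ j - lam‖) '' {j | Λ j ≠ lam} with hS
  have hfin : S.Finite := (Set.toFinite _).image _
  have hne : S.Nonempty := ⟨_, i, hi, rfl⟩
  have hmem := hne.csInf_mem hfin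
  have hpos : 0 < eigGap Λ lam μ := by
    obtain ⟨j, hj, hje⟩ := hmem
    have : eigGap Λ lam μ = sInf S := rfl
    rw [this, ← hje]
    exact div_pos (norm_pos_iff.mpr (sub_ne_zero.mpr (h.eigComb_ne hp hΛ hmult hsep hj)))
      (norm_pos_iff.mpr (sub_ne_zero.mpr hj))
  have hle : eigGap Λ lam μ ≤ ‖eigComb (Λ i) μ - eigComb lam μ‖ / ‖Λ i - lam‖ :=
    csInf_le hfin.bddBelow ⟨i, hi, rfl⟩
  have hn : 0 < ‖Λ i - lam‖ := norm_pos_iff.mpr (sub_ne_zero.mpr hi)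
  rw [le_div_iff₀ hn] at hle
  rw [le_div_iff₀ hpos]
  linarith

lemma IsBlockDiagonalization.isDiag_block (h : IsBlockDiagonalization A lam X₁ X₂ Y₁ Y₂ A₂₂)
    (hd : ∀ k, ((Matrix.fromCols Y₁ Y₂)ᴴ * A k * Matrix.fromCols X₁ X₂).IsDiag) (k : Fin d) :
    A₂₂ k = Matrix.diagonal fun j => diagTuple A₂₂ j k := by
  have h1 := hd k
  rw [h.block k] at h1
  ext i j
  rcases eq_or_ne i j with rfl | hij
  · simp [diagTuple]
  · rw [Matrix.diagonal_apply_ne _ hij]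
    exact h1 (i := Sum.inr i) (j := Sum.inr j) (by simpa using hij)

/-- The columns of `X₂` are common eigenvectors, nonzero because `Y₂ᴴ X₂ = 1`. This ties the
diagonal of `A₂₂` to the list `Λ` used in `eigGap`. -/
lemma IsBlockDiagonalization.exists_eq_diagTuple
    (h : IsBlockDiagonalization A lam X₁ X₂ Y₁ Y₂ A₂₂) (hp : p ≤ n)
    (hΛ : IsJointEigenvalueList A Λ)
    (hdiag : ∀ k, A₂₂ k = Matrix.diagonal fun j => diagTuple A₂₂ j k) (j : Fin (n - p)) :
    ∃ i, Λ i = diagTuple A₂₂ j := by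
  obtain ⟨h11, h12, h21, h22⟩ := h.dual_blocks
  refine hΛ.exists_eq_of_common_eigenvector (x := fun a => X₂ a j) ?_ fun k => ?_
  · intro h0
    have h1 := congrFun (congrFun h22 j) j
    rw [Matrix.mul_apply, Matrix.one_apply_eq] at h1
    simp only [fun a => congrFun h0 a, Pi.zero_apply, mul_zero, Finset.sum_const_zero] at h1
    exact zero_ne_one h1
  · have h1 : A k * X₂ = X₂ * A₂₂ k := by
      rw [h.eq_add hp k, Matrix.add_mul, Matrix.smul_mul, Matrix.mul_assoc, h12,
        Matrix.mul_assoc, Matrix.mul_assoc, h22]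
      simp
    rw [hdiag k] at h1
    ext a
    have h2 := congrFun (congrFun h1 a) j
    rw [Matrix.mul_diagonal] at h2
    rw [Pi.smul_apply, smul_eq_mul, mul_comm, ← h2]
    rfl

lemma formVec_mul_diagonal_mul {m : ℕ} (T : Fin m → EuclideanSpace ℂ (Fin d))
    (g b : Matrix (Fin m) Unit ℂ) :
    formVec (fun k => Matrix.diagonal fun j => T j k) g b =
      ∑ j, (star (g j ()) * b j ()) • T j := by
  ext k
  have e : formVec (fun k => Matrix.diagonal fun j => T j k) g b k =
      ∑ j, (gᴴ * Matrix.diagonal fun j => T j k) () j * b j () := Matrix.mul_apply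
  rw [e]
  simp only [Matrix.mul_diagonal, WithLp.ofLp_sum, Finset.sum_apply, PiLp.smul_apply,
    smul_eq_mul, Matrix.conjTranspose_apply]
  exact Finset.sum_congr rfl fun j _ => by ring

/-- The quadratic forms of a diagonal family are controlled by the largest ratio of the tuples to
the values of a linear combination. -/
lemma norm_formVec_diagonal_le {m : ℕ} (T : Fin m → EuclideanSpace ℂ (Fin d)) (t : Fin m → ℂ)
    {c : ℝ} (hT : ∀ j, ‖T j‖ ≤ c * ‖t j‖) (hc : 0 ≤ c) (g b : Matrix (Fin m) Unit ℂ) :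
    ‖formVec (fun k => Matrix.diagonal fun j => T j k) g b‖ ≤
      c * (‖g‖ * ‖Matrix.diagonal t * b‖) := by
  rw [formVec_mul_diagonal_mul]
  calc _ ≤ ∑ j, ‖g j ()‖ * ‖b j ()‖ * (c * ‖t j‖) := by
        refine (norm_sum_le _ _).trans (Finset.sum_le_sum fun j _ => ?_)
        rw [norm_smul, norm_mul, norm_star]
        gcongr
        exact hT j
    _ = c * ∑ j, ‖g j ()‖ * ‖(Matrix.diagonal t * b) j ()‖ := by
        rw [Finset.mul_sum]
        refine Finset.sum_congr rfl fun j _ => ?_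
        rw [Matrix.diagonal_mul, norm_mul]
        ring
    _ ≤ c * (√(∑ j, ‖g j ()‖ ^ 2) * √(∑ j, ‖(Matrix.diagonal t * b) j ()‖ ^ 2)) := by
        gcongr
        exact Real.sum_mul_le_sqrt_mul_sqrt _ _ _
    _ = _ := by
        rw [← norm_sq_column, ← norm_sq_column, Real.sqrt_sq (norm_nonneg _),
          Real.sqrt_sq (norm_nonneg _)]

lemma IsPerturbedPair.one_sided_le (h : IsBlockDiagonalization A lam X₁ X₂ Y₁ Y₂ A₂₂)
    (hp : p ≤ n) (hΛ : IsJointEigenvalueList A Λ) (hmult : algMultiplicity Λ lam = p)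
    (hsep : ¬ Module.End.HasEigenvalue (Matrix.toLin' (JointEig.matComb A₂₂ μ)) (eigComb lam μ))
    (hdiag : ∀ k, A₂₂ k = Matrix.diagonal fun j => diagTuple A₂₂ j k)
    (hμ : ‖μ‖ = 1) {K L : ℝ} (hL : 0 ≤ L)
    {E : Fin d → Matrix (Fin n) (Fin n) ℂ} (hE : ∑ k, frobNorm (E k) ^ 2 = 1) {ε : ℝ} (hε : 0 < ε)
    {x y : Matrix (Fin n) Unit ℂ} {θ : ℂ}
    (hxy : IsPerturbedPair A lam X₂ Y₂ A₂₂ μ K L E ε x y θ) :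
    ‖formVec (fun k => A k + (ε : ℂ) • E k) x x - lam‖ ≤
      (1 + √(d : ℝ) * ‖X₂‖ * ‖Y₂‖ / eigGap Λ lam μ) * ε +
        ‖X₂‖ * K * L / eigGap Λ lam μ * ε ^ 2 := by
  have hE1 := norm_matComb_le_one hE hμ
  have hx1 := hxy.norm_right
  have hxx : xᴴ * x = 1 := by
    have e : (xᴴ * x) () () = 1 := by
      have e1 : (xᴴ * x) () () = ((∑ i, ‖x i ()‖ ^ 2 : ℝ) : ℂ) := by
        simp [Matrix.mul_apply, Complex.conj_mul']
      rw [e1, ← norm_sq_column, hx1]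
      simp
    ext _ _
    rw [Matrix.one_apply_eq]
    exact e
  -- The estimate is obtained with `1` in place of `√d`; `‖μ‖ = 1` excludes `d = 0`.
  have hd : (1 : ℝ) ≤ √(d : ℝ) := by
    rw [Real.one_le_sqrt, Nat.one_le_cast]
    rcases Nat.eq_zero_or_pos d with rfl | hd
    · rw [Subsingleton.elim μ 0, norm_zero] at hμ
      exact absurd hμ zero_ne_one
    · exact hd
  set G := eigGap Λ lam μ with hG
  have hG0 : 0 ≤ G := eigGap_nonneg Λ lam μ
  set b := Y₂ᴴ * x with hb
  set t : Fin (n - p) → ℂ := fun j => eigComb (diagTuple A₂₂ j) μ - eigComb lam μ with ht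
  have hblock : ∀ k, A₂₂ k - lam k • (1 : Matrix (Fin (n - p)) (Fin (n - p)) ℂ) =
      Matrix.diagonal fun j => (diagTuple A₂₂ j - lam) k := by
    intro k
    rw [hdiag k, Matrix.smul_one_eq_diagonal, Matrix.diagonal_sub]
    rfl
  have hmat : JointEig.matComb A₂₂ μ - eigComb lam μ • 1 = Matrix.diagonal t := by
    have e : JointEig.matComb A₂₂ μ =
        Matrix.diagonal fun j => eigComb (diagTuple A₂₂ j) μ := by
      ext i j
      rcases eq_or_ne i j with rfl | hij
      · rw [matComb_apply_diag, Matrix.diagonal_apply_eq]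
      · rw [Matrix.diagonal_apply_ne _ hij, JointEig.matComb, Matrix.sum_apply]
        refine Finset.sum_eq_zero fun k _ => ?_
        rw [hdiag k, Matrix.smul_apply, Matrix.diagonal_apply_ne _ hij, smul_zero]
    rw [e, Matrix.smul_one_eq_diagonal, Matrix.diagonal_sub]
  -- The term with `θ - λ(μ)` is a product of two first-order quantities; only `‖Y₂‖ ε` is of first
  -- order.
  have hw : ‖Matrix.diagonal t * b‖ ≤ K * ε * (L * ε) + ‖Y₂‖ * ε := by
    rw [← hmat, hxy.component_eq]
    refine (norm_sub_le _ _).trans (add_le_add ?_ ?_)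
    · rw [norm_smul]
      refine mul_le_mul hxy.shift_le (hxy.right_le.trans ?_) (norm_nonneg _)
        ((norm_nonneg _).trans hxy.shift_le)
      exact mul_le_of_le_one_right (by positivity) hE1
    · refine (Matrix.l2_opNorm_mul _ _).trans ?_
      rw [Matrix.l2_opNorm_conjTranspose]
      gcongr
      refine (Matrix.l2_opNorm_mul _ _).trans ?_
      rw [hx1, mul_one, norm_smul, Complex.norm_real, Real.norm_of_nonneg hε.le]
      exact mul_le_of_le_one_right hε.le hE1
  have hT : ∀ j, ‖diagTuple A₂₂ j - lam‖ ≤ 1 / G * ‖t j‖ := by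
    intro j
    obtain ⟨i, hi⟩ := h.exists_eq_diagTuple hp hΛ hdiag j
    have e := h.norm_sub_le_div_eigGap hp hΛ hmult hsep i
    rw [hi] at e
    rwa [one_div_mul_eq_div]
  have hg : ‖X₂ᴴ * x‖ ≤ ‖X₂‖ := by
    refine (Matrix.l2_opNorm_mul _ _).trans ?_
    rw [Matrix.l2_opNorm_conjTranspose, hx1, mul_one]
  have hq : ‖formVec (fun k => A k - lam k • (1 : Matrix (Fin n) (Fin n) ℂ)) x x‖ ≤
      1 / G * (‖X₂‖ * (K * ε * (L * ε) + ‖Y₂‖ * ε)) := by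
    have e : formVec (fun k => A k - lam k • (1 : Matrix (Fin n) (Fin n) ℂ)) x x =
        formVec (fun k => Matrix.diagonal fun j => (diagTuple A₂₂ j - lam) k) (X₂ᴴ * x) b := by
      ext k
      simp only [formVec, h.sub_smul_one hp k, hblock, hb, Matrix.conjTranspose_mul,
        Matrix.conjTranspose_conjTranspose, Matrix.mul_assoc]
    rw [e]
    refine (norm_formVec_diagonal_le _ t hT (by positivity) _ _).trans ?_
    gcongr
  have hV : ‖formVec E x x‖ ≤ 1 := by
    have e := (norm_formVec_le_and_norm_matComb_le E hE hμ hx1 (y := x) (by rw [hx1]; norm_num)).1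
    rw [hx1, one_pow, div_one] at e
    exact (sq_le_one_iff₀ (norm_nonneg _)).mp e
  rw [formVec_perturbation_sub A E lam ε hxx]
  calc _ ≤ 1 / G * (‖X₂‖ * (K * ε * (L * ε) + ‖Y₂‖ * ε)) + ε := by
        refine (norm_add_le _ _).trans (add_le_add hq ?_)
        rw [norm_smul, Complex.norm_real, Real.norm_of_nonneg hε.le]
        exact mul_le_of_le_one_right hε.le hV
    _ = (1 + 1 * ‖X₂‖ * ‖Y₂‖ / G) * ε + ‖X₂‖ * K * L / G * ε ^ 2 := by ring
    _ ≤ _ := by gcongr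

end Diagonal

end JointEig

/-! ### The two bounds with uniform constants -/

theorem theorem3 {n d p : ℕ}
    (A : Fin d → Matrix (Fin n) (Fin n) ℂ) (hA : JointEig.IsCommutingFamily A)
    (Λ : Fin n → EuclideanSpace ℂ (Fin d)) (hΛ : JointEig.IsJointEigenvalueList A Λ)
    (lam : EuclideanSpace ℂ (Fin d)) (hlam : JointEig.IsSemisimpleJointEigenvalue A Λ lam p)
    (X₁ : Matrix (Fin n) (Fin p) ℂ) (X₂ : Matrix (Fin n) (Fin (n - p)) ℂ)
    (Y₁ : Matrix (Fin n) (Fin p) ℂ) (Y₂ : Matrix (Fin n) (Fin (n - p)) ℂ)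
    (A₂₂ : Fin d → Matrix (Fin (n - p)) (Fin (n - p)) ℂ)
    (hXY : JointEig.IsBlockDiagonalization A lam X₁ X₂ Y₁ Y₂ A₂₂)
    (μ : EuclideanSpace ℂ (Fin d)) (hμ : ‖μ‖ = 1)
    (hsep : ¬ Module.End.HasEigenvalue (Matrix.toLin' (JointEig.matComb A₂₂ μ))
      (JointEig.eigComb lam μ)) :
    (∃ C δ : ℝ, 0 < δ ∧
      ∀ E : Fin d → Matrix (Fin n) (Fin n) ℂ, ∑ k, JointEig.frobNorm (E k) ^ 2 = 1 →
      ∀ ε : ℝ, 0 < ε → ε < δ →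
      ∀ Xt Yt : Matrix (Fin n) (Fin p) ℂ,
        JointEig.IsClosestEigenbasis (JointEig.matComb (fun k => A k + (ε : ℂ) • E k) μ)
          (JointEig.eigComb lam μ) Xt Yt →
        ∀ i : Fin p,
          ‖JointEig.rq2 (fun k => A k + (ε : ℂ) • E k)
              (JointEig.colVec Xt i) (JointEig.colVec Yt i) - lam‖
            ≤ ‖JointEig.colVec Yt i‖ * ε + C * ε ^ 2) ∧
    ((∀ k, ((Matrix.fromCols Y₁ Y₂)ᴴ * A k * Matrix.fromCols X₁ X₂).IsDiag) →
      ∃ C δ : ℝ, 0 < δ ∧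
        ∀ E : Fin d → Matrix (Fin n) (Fin n) ℂ, ∑ k, JointEig.frobNorm (E k) ^ 2 = 1 →
        ∀ ε : ℝ, 0 < ε → ε < δ →
        ∀ Xt Yt : Matrix (Fin n) (Fin p) ℂ,
          JointEig.IsClosestEigenbasis (JointEig.matComb (fun k => A k + (ε : ℂ) • E k) μ)
            (JointEig.eigComb lam μ) Xt Yt →
          ∀ i : Fin p,
            ‖JointEig.rq1 (fun k => A k + (ε : ℂ) • E k) (JointEig.colVec Xt i) - lam‖
              ≤ (1 + √(d : ℝ) * ‖X₂‖ * ‖Y₂‖ / JointEig.eigGap Λ lam μ) * ε + C * ε ^ 2) := by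
  obtain ⟨-, hmult, -⟩ := hlam
  have hp : p ≤ n := by
    rw [← hmult, JointEig.algMultiplicity]
    exact (Finite.card_subtype_le _).trans_eq (Nat.card_fin n)
  obtain ⟨K, L, δ, hK, hL, hδ, hpair⟩ := hXY.exists_isPerturbedPair hp hμ hsep
  refine ⟨?_, fun hd => ?_⟩
  · obtain ⟨Q, hQ⟩ : ∃ Q, Q = (∑ k, ‖A₂₂ k -
        lam k • (1 : Matrix (Fin (n - p)) (Fin (n - p)) ℂ)‖) * L ^ 2 := ⟨_, rfl⟩
    have hQ0 : 0 ≤ Q := by rw [hQ]; positivity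
    refine ⟨16 * Q * K ^ 2, min δ (1 / (12 * (Q + 1))), by positivity, ?_⟩
    intro E hE ε hε hεδ Xt Yt hXt i
    obtain ⟨θ, hθ⟩ := hpair E hE ε hε (hεδ.trans_le (min_le_left _ _)) Xt Yt hXt i
    have hεQ : 12 * (Q * ε) ≤ 1 := by
      have h1 := hεδ.le.trans (min_le_right _ _)
      rw [le_div_iff₀ (by positivity)] at h1
      linarith
    rw [JointEig.rq2_eq_formVec, ← JointEig.norm_col]
    exact hθ.two_sided_le hXY hp hμ hK hL hE hε hQ hεQ
  · refine ⟨‖X₂‖ * K * L / JointEig.eigGap Λ lam μ, δ, hδ, ?_⟩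
    intro E hE ε hε hεδ Xt Yt hXt i
    obtain ⟨θ, hθ⟩ := hpair E hE ε hε hεδ Xt Yt hXt i
    rw [JointEig.rq1_eq_formVec]
    exact hθ.one_sided_le hXY hp hΛ hmult hsep (hXY.isDiag_block hd) hμ hL hE hε
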